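/- Let $\mathbb F$ be a finite field and $c\ge 2$. An algebra means a (not necessarily associative or unital) $\mathbb F$-algebra. For an algebra $P$, let $P^i$ be the linear span of the values in $P$ of all nonassociative monomials of degree $i$, and let $I(P)=\{x\in P : ax=xa=0 \text{ for all } a\in P\}$ be its annihilator. Let $\mathfrak V$ be a primitive class (variety) of algebras over $\mathbb F$, that is, the class of all algebras satisfying a given set $V$ of identities $v(x_1,\dots,x_m)=0$, where the $v$ are nonassociative polynomials over $\mathbb F$, and let $F_n(\mathfrak V)$ be the $\mathfrak V$-free algebra of rank $n$, the quotient of the absolutely free nonassociative algebra of rank $n$ by the ideal generated by all values of the polynomials in $V$. Assume that $\mathfrak V$ is $c$-step nilpotent ($P^{c+1}=0$ for all $P\in\mathfrak V$, and $P^c\neq 0$ for some $P\in\mathfrak V$) and central ($I(F_n(\mathfrak V))=F_n(\mathfrak V)^c$ for all $n\ge 2$). Then every derivation of a generic finitely generated algebra $P\in\mathfrak V$ is scalar modulo $P^2$, in the following sense. For each $n$ let $S_n$ be the set of isomorphism classes of algebras in $\mathfrak V$ that can be generated by $n$ elements, and let $T_n\subseteq S_n$ be the set of classes of those $P$ such that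 for every derivation $d$ of $P$ (a linear map $d:P\to P$ with $d(ab)=d(a)b+a\,d(b)$) there is $\lambda\in\mathbb F$ with $d(a)-\lambda a\in P^2$ for all $a\in P$. Then all the sets $S_n$ are finite and $$\lim_{n\to\infty}\frac{|T_n|}{|S_n|}=1 .$$ -/

import Mathlib

open Filter Topology

universe u v

namespace NonassocVar

section Basic

variable (F : Type u) [Field F]
variable (A : Type v) [NonUnitalNonAssocRing A] [Module F A]

/-- The power `A ^ i` of a nonassociative algebra: the linear span of the values in `A` of all
nonassociative monomials of degree `i`. -/
def power (i : ℕ) : Submodule F A :=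
  Submodule.span F ((FreeMagma.lift (id : A → A)) '' {w : FreeMagma A | w.length = i})

/-- The set of elements annihilating `A` from both sides, that is the annihilator `I(A)`. -/
def annihilator : Set A := {x | ∀ a : A, a * x = 0 ∧ x * a = 0}

/-- A linear map is a derivation if it satisfies the Leibniz rule. -/
def IsDerivation (d : A →ₗ[F] A) : Prop :=
  ∀ a b : A, d (a * b) = d a * b + a * d b

/-- Every derivation `d` of `A` is scalar modulo `A ^ 2`. -/
def DerivationsScalar : Prop :=
  ∀ d : A →ₗ[F] A, IsDerivation F A d → ∃ l : F, ∀ a : A, d a - l • a ∈ power F A 2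

variable [IsScalarTower F A A] [SMulCommClass F A A]

/-- `A` is generated, as an algebra, by `n` (not necessarily distinct) elements. -/
def IsGeneratedBy (n : ℕ) : Prop :=
  ∃ a : Fin n → A, NonUnitalAlgebra.adjoin F (Set.range a) = ⊤

/-- `A` belongs to the primitive class defined by `V`: all the identical relations `w = 0`,
`w ∈ V`, hold in `A`. -/
def InClass (V : Set (FreeNonUnitalNonAssocAlgebra F ℕ)) : Prop :=
  ∀ w ∈ V, ∀ a : ℕ → A, FreeNonUnitalNonAssocAlgebra.lift F a w = 0

end Basic

section Quotients

/-- A two-sided ideal of a nonassociative algebra over a field. -/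
structure AlgIdeal (F : Type u) [Field F] (A : Type v) [NonUnitalNonAssocRing A] [Module F A]
    extends Submodule F A where
  mul_left_mem : ∀ (a : A) {x : A}, x ∈ carrier → a * x ∈ carrier
  mul_right_mem : ∀ (a : A) {x : A}, x ∈ carrier → x * a ∈ carrier

variable {F : Type u} [Field F] {A : Type v} [NonUnitalNonAssocRing A] [Module F A]

/-- The quotient algebra by an ideal: the quotient vector space with the induced product. -/
def AlgIdeal.Quot (I : AlgIdeal F A) : Type v := A ⧸ I.toSubmodule

instance (I : AlgIdeal F A) : AddCommGroup I.Quot :=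
  inferInstanceAs (AddCommGroup (A ⧸ I.toSubmodule))

instance (I : AlgIdeal F A) : Module F I.Quot :=
  inferInstanceAs (Module F (A ⧸ I.toSubmodule))

/-- The canonical projection onto the quotient algebra. -/
def AlgIdeal.proj (I : AlgIdeal F A) : A →ₗ[F] I.Quot := I.toSubmodule.mkQ

theorem AlgIdeal.proj_surjective (I : AlgIdeal F A) : Function.Surjective I.proj :=
  I.toSubmodule.mkQ_surjective

theorem AlgIdeal.proj_eq (I : AlgIdeal F A) {x y : A} :
    I.proj x = I.proj y ↔ x - y ∈ I.toSubmodule :=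
  Submodule.Quotient.eq I.toSubmodule

instance (I : AlgIdeal F A) : Mul I.Quot where
  mul := Quotient.map₂ (· * ·) (by
    intro a b hab c d hcd
    have h1 : a - b ∈ I.toSubmodule := (Submodule.quotientRel_def _).1 hab
    have h2 : c - d ∈ I.toSubmodule := (Submodule.quotientRel_def _).1 hcd
    refine (Submodule.quotientRel_def _).2 ?_
    have e : a * c - b * d = (a - b) * c + b * (c - d) := by
      rw [sub_mul, mul_sub]; abel
    change a * c - b * d ∈ I.toSubmodule
    rw [e]
    exact I.toSubmodule.add_mem (I.mul_right_mem c h1) (I.mul_left_mem b h2))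

theorem AlgIdeal.proj_mul (I : AlgIdeal F A) (x y : A) : I.proj (x * y) = I.proj x * I.proj y := rfl

instance (I : AlgIdeal F A) : NonUnitalNonAssocRing I.Quot :=
  { (inferInstance : AddCommGroup I.Quot), (inferInstance : Mul I.Quot) with
    left_distrib := by
      intro a b c
      obtain ⟨a, rfl⟩ := I.proj_surjective a
      obtain ⟨b, rfl⟩ := I.proj_surjective b
      obtain ⟨c, rfl⟩ := I.proj_surjective c
      rw [← map_add, ← I.proj_mul, mul_add, map_add, I.proj_mul, I.proj_mul]
    right_distrib := by
      intro a b c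
      obtain ⟨a, rfl⟩ := I.proj_surjective a
      obtain ⟨b, rfl⟩ := I.proj_surjective b
      obtain ⟨c, rfl⟩ := I.proj_surjective c
      rw [← map_add, ← I.proj_mul, add_mul, map_add, I.proj_mul, I.proj_mul]
    zero_mul := by
      intro a
      obtain ⟨a, rfl⟩ := I.proj_surjective a
      rw [← map_zero I.proj, ← I.proj_mul, zero_mul]
    mul_zero := by
      intro a
      obtain ⟨a, rfl⟩ := I.proj_surjective a
      rw [← map_zero I.proj, ← I.proj_mul, mul_zero] }

instance [IsScalarTower F A A] (I : AlgIdeal F A) : IsScalarTower F I.Quot I.Quot where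
  smul_assoc := by
    intro r a b
    obtain ⟨a, rfl⟩ := I.proj_surjective a
    obtain ⟨b, rfl⟩ := I.proj_surjective b
    change (r • I.proj a) * I.proj b = r • (I.proj a * I.proj b)
    rw [← map_smul, ← I.proj_mul, ← I.proj_mul, ← map_smul, smul_mul_assoc]

instance [SMulCommClass F A A] (I : AlgIdeal F A) : SMulCommClass F I.Quot I.Quot where
  smul_comm := by
    intro r a b
    obtain ⟨a, rfl⟩ := I.proj_surjective a
    obtain ⟨b, rfl⟩ := I.proj_surjective b
    change r • (I.proj a * I.proj b) = I.proj a * (r • I.proj b)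
    rw [← map_smul, ← I.proj_mul, ← I.proj_mul, ← map_smul, mul_smul_comm]

end Quotients

section Classes

variable {F : Type u} [Field F]

/-- The verbal ideal of `A` defined by `V`: the least ideal of `A` containing all values in `A` of
the polynomials from `V`. -/
def verbalIdeal (V : Set (FreeNonUnitalNonAssocAlgebra F ℕ))
    (A : Type v) [NonUnitalNonAssocRing A] [Module F A]
    [IsScalarTower F A A] [SMulCommClass F A A] : AlgIdeal F A where
  toSubmodule := sInf {J : Submodule F A |
    (∀ w ∈ V, ∀ a : ℕ → A, FreeNonUnitalNonAssocAlgebra.lift F a w ∈ J) ∧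
    ∀ (a : A), ∀ x ∈ J, a * x ∈ J ∧ x * a ∈ J}
  mul_left_mem := fun a x hx => (Submodule.mem_sInf).2 fun J hJ =>
    (hJ.2 a x ((Submodule.mem_sInf).1 hx J hJ)).1
  mul_right_mem := fun a x hx => (Submodule.mem_sInf).2 fun J hJ =>
    (hJ.2 a x ((Submodule.mem_sInf).1 hx J hJ)).2

/-- The relatively free algebra of rank `n` of the primitive class defined by `V`: the absolutely
free algebra on `n` generators modulo its verbal ideal. -/
abbrev RelFree (V : Set (FreeNonUnitalNonAssocAlgebra F ℕ)) (n : ℕ) : Type u :=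
  (verbalIdeal V (FreeNonUnitalNonAssocAlgebra F (Fin n))).Quot

/-- A (nonassociative, nonunital) algebra over `F`, bundled. -/
structure Alg (F : Type u) [Field F] : Type (u + 1) where
  carrier : Type u
  [ring : NonUnitalNonAssocRing carrier]
  [module : Module F carrier]
  [tower : IsScalarTower F carrier carrier]
  [comm : SMulCommClass F carrier carrier]

attribute [instance] Alg.ring Alg.module Alg.tower Alg.comm

/-- Isomorphism of algebras as an equivalence relation. -/
def algSetoid (F : Type u) [Field F] : Setoid (Alg F) where
  r P Q := ∃ f : P.carrier →ₙₐ[F] Q.carrier, Function.Bijective f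
  iseqv :=
    { refl := fun P => ⟨NonUnitalAlgHom.id F P.carrier, Function.bijective_id⟩
      symm := by
        rintro P Q ⟨f, hf⟩
        let e : P.carrier ≃ Q.carrier := Equiv.ofBijective f hf
        exact ⟨NonUnitalAlgHom.inverse f e.symm e.left_inv e.right_inv, e.symm.bijective⟩
      trans := by
        rintro P Q R ⟨f, hf⟩ ⟨g, hg⟩
        exact ⟨g.comp f, hg.comp hf⟩ }

/-- The primitive class defined by `V` is `c`-step nilpotent: `P ^ (c + 1) = 0` for all its
algebras `P`, and `P ^ c ≠ 0` for at least one of them. -/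
def IsStepNilpotentClass (V : Set (FreeNonUnitalNonAssocAlgebra F ℕ)) (c : ℕ) : Prop :=
  (∀ P : Alg F, InClass F P.carrier V → power F P.carrier (c + 1) = ⊥) ∧
  ∃ P : Alg F, InClass F P.carrier V ∧ power F P.carrier c ≠ ⊥

/-- The primitive class defined by `V` is central (with respect to `c`): the annihilator of each
relatively free algebra of rank `n ≥ 2` equals its `c`-th power. -/
def IsCentralClass (V : Set (FreeNonUnitalNonAssocAlgebra F ℕ)) (c : ℕ) : Prop :=
  ∀ n : ℕ, 2 ≤ n → annihilator (RelFree V n) = (power F (RelFree V n) c : Set (RelFree V n))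

/-- The set of isomorphism classes of `n`-generated algebras `P` which lie in the primitive class
defined by `V` and have the property `p`. -/
def isoClasses (V : Set (FreeNonUnitalNonAssocAlgebra F ℕ)) (p : Alg F → Prop) (n : ℕ) :
    Set (Quotient (algSetoid F)) :=
  {x | ∃ P : Alg F, Quotient.mk (algSetoid F) P = x ∧
    InClass F P.carrier V ∧ IsGeneratedBy F P.carrier n ∧ p P}

end Classes

/-- For finite sets `S n` and subsets `T n ⊆ S n`: a generic element of the family `S` is in the
family `T`, that is `|T n| / |S n| → 1`. -/
def IsGeneric {α : Type v} (S T : ℕ → Set α) : Prop :=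
  (∀ n, (S n).Finite) ∧ (∀ n, T n ⊆ S n) ∧
  Tendsto (fun n => ((T n).ncard : ℝ) / ((S n).ncard : ℝ)) atTop (𝓝 1)

end NonassocVar

namespace NonassocVar

/-! ### Counting subspaces over a finite field -/

section Counting

/-! Write A for the relatively free algebra of rank n, q = |F| and d = dim A^c. The n-generated
algebras of the class are the quotients of A by ideals, and every subspace of A^c is an ideal
because A^c is the annihilator. There are at least q^(d²/4) such central ideals
(`pow_le_card_submodule`). An isomorphism between two quotients lifts to an endomorphism of A, whose
action on A^c depends only on its linear part since A^(c+1) = 0; so an isomorphism class contains at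
most q^(n²) central ideals (`ncard_quotClass_fiber_le`), and |S_n| ≥ q^(d²/4 - n²). For large n one
has n² ≤ 8cd (`finrank_relFree_le`). Hence it suffices to save a fixed, large enough multiple of d
in the exponent when counting bad ideals, and forcing a constant number of dimensions into a
subspace achieves this, the exponent being quadratic.

Noncentral ideals are rare. If k = dim I/(I ∩ A^c), then dim (I ∩ A^c) is at least a large multiple
ak of k (`finrank_ideal_bound`): multiplication by a generator outside the support of an element is
injective modulo A^c, up to a factor 2 for the two sides, and there are many generators. Choosing k
vectors costs at most q^(2dk), but forces ak dimensions into I ∩ A^c (`ncard_ideals_le`).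

Central ideals with a nonscalar derivation are rare as well. Modulo squares the derivation is given
by a nonscalar n × n matrix, one of q^(n²). The matrix extends to a derivation of the absolutely
free algebra, and nilpotency makes I stable under the linear relation which it induces on A^c. A
relation is needed since a verbal ideal over a finite field need not be stable under derivations. A
nonzero multilinear product shows that the relation differs from every scalar by rank at least n - c
(`le_finrank_range_derPower`), and such a relation has few stable subspaces (`ncard_stable_le`): a
typical vector of I brings its image along, so one choice fixes two dimensions.

Altogether the proportion of bad classes is at most 3/n. -/

theorem ncard_mul_le_card_mul {α β : Type*} [Finite α] [Finite β] (S : Set α) (r : α → β → Prop)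
    {m l : ℕ} (h1 : ∀ a ∈ S, m ≤ {b | r a b}.ncard) (h2 : ∀ b, {a ∈ S | r a b}.ncard ≤ l) :
    S.ncard * m ≤ Nat.card β * l := by
  classical
  have := Fintype.ofFinite α
  have := Fintype.ofFinite β
  have key := Finset.card_mul_le_card_mul (s := S.toFinset) (t := (Finset.univ : Finset β)) r
    (m := m) (n := l) (fun a ha => ?_) (fun b _ => ?_)
  · rwa [← Set.ncard_eq_toFinset_card', Finset.card_univ, ← Nat.card_eq_fintype_card] at key
  · refine (h1 a (by simpa using ha)).trans (le_of_eq ?_)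
    rw [← Set.ncard_coe_finset]
    congr 1
    ext b; simp [Finset.bipartiteAbove]
  · refine (le_of_eq ?_).trans (h2 b)
    rw [← Set.ncard_coe_finset]
    congr 1
    ext b; simp [Finset.bipartiteBelow]

variable {F : Type*} [Field F] [Finite F]
variable {W : Type*} [AddCommGroup W] [Module F W] [FiniteDimensional F W]

local notation "q" => Nat.card F


theorem finite_submodule : Finite (Submodule F W) :=
  have := Module.finite_of_finite F (M := W)
  inferInstance

theorem two_le_card_field : 2 ≤ q := by
  have := Fintype.ofFinite F
  exact Finite.one_lt_card

omit [Finite F] in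
theorem finrank_map_add_finrank_inf_ker {W' : Type*} [AddCommGroup W'] [Module F W']
    (f : W →ₗ[F] W') (I : Submodule F W) :
    Module.finrank F (I.map f) + Module.finrank F (I ⊓ LinearMap.ker f : Submodule F W) =
      Module.finrank F I := by
  have h := (f.domRestrict I).finrank_range_add_finrank_ker
  rw [LinearMap.range_domRestrict, LinearMap.ker_domRestrict] at h
  rw [← h, ← Submodule.map_comap_subtype, Submodule.finrank_map_subtype_eq]

omit [Finite F] in
theorem card_eq_pow : Nat.card W = q ^ Module.finrank F W := Module.natCard_eq_pow_finrank

theorem pow_pred_le_sub {Q r i : ℕ} (hQ : 2 ≤ Q) (hi : i < r) : Q ^ (r - 1) ≤ Q ^ r - Q ^ i := by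
  obtain ⟨r, rfl⟩ : ∃ k, r = k + 1 := ⟨r - 1, by omega⟩
  have h1 : Q ^ i ≤ Q ^ r := Nat.pow_le_pow_right (by omega) (by omega)
  have h2 : 2 * Q ^ r ≤ Q ^ (r + 1) := by rw [pow_succ, mul_comm]; gcongr
  simp only [Nat.add_sub_cancel]
  omega

theorem pow_le_card_linearIndependent :
    q ^ ((Module.finrank F W - 1) * Module.finrank F W) ≤
      Nat.card {s : Fin (Module.finrank F W) → W // LinearIndependent F s} := by
  have := Fintype.ofFinite F
  have := Module.finite_of_finite F (M := W)
  have := Fintype.ofFinite W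
  rw [card_linearIndependent le_rfl, pow_mul, ← Nat.card_eq_fintype_card]
  calc _ = ∏ i : Fin (Module.finrank F W), q ^ (Module.finrank F W - 1) := by simp
    _ ≤ _ := Finset.prod_le_prod' fun i _ => pow_pred_le_sub two_le_card_field i.2

/-- A crude Gaussian binomial with m = dim W: among the q^(mr) tuples, each `I` accounts for at
least q^((r-1)r) bases, and a basis determines its span. -/
theorem ncard_finrank_eq_le (r : ℕ) :
    {I : Submodule F W | Module.finrank F I = r}.ncard ≤
      q ^ (r * (Module.finrank F W + 1 - r)) := by
  set m := Module.finrank F W with hm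
  have := Module.finite_of_finite F (M := W)
  by_cases hr : r ≤ m
  swap
  · have : {I : Submodule F W | Module.finrank F I = r} = ∅ := by
      ext I
      have := Submodule.finrank_le I
      simp; omega
    simp [this]
  have key := ncard_mul_le_card_mul {I : Submodule F W | Module.finrank F I = r}
    (fun I (x : Fin r → W) => LinearIndependent F x ∧ ∀ i, x i ∈ I)
    (m := q ^ ((r - 1) * r)) (l := 1) ?_ ?_
  · rw [mul_one] at key
    have hW : Nat.card W = q ^ m := card_eq_pow
    rw [Nat.card_fun, hW, Nat.card_fin, ← pow_mul] at key
    refine le_of_mul_le_mul_right (key.trans (le_of_eq ?_)) (pow_pos Nat.card_pos ((r - 1) * r))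
    rw [← pow_add]
    congr 1
    rw [mul_comm, mul_comm (r - 1) r, ← mul_add]
    rcases Nat.eq_zero_or_pos r with h | h
    · simp [h]
    · congr 1; omega
  · rintro I rfl
    refine pow_le_card_linearIndependent.trans ?_
    rw [← Nat.card_coe_set_eq]
    refine Nat.card_le_card_of_injective
      (fun s => ⟨fun i => (s.1 i : W), ?_, fun i => (s.1 i).2⟩) ?_
    · exact s.2.map' I.subtype (Submodule.ker_subtype I)
    · intro s t h
      ext i
      exact congr_fun (congr_arg Subtype.val h) i
  · intro x
    rw [Set.ncard_le_one]
    have : ∀ I ∈ {I ∈ {I : Submodule F W | Module.finrank F I = r} |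
        LinearIndependent F x ∧ ∀ i, x i ∈ I}, I = Submodule.span F (Set.range x) := by
      rintro I ⟨h1, h2, h3⟩
      refine (Submodule.eq_of_le_of_finrank_eq ?_ ?_).symm
      · rw [Submodule.span_le]; rintro _ ⟨i, rfl⟩; exact h3 i
      · rw [finrank_span_eq_card h2, h1, Fintype.card_fin]
    intro I hI J hJ
    rw [this I hI, this J hJ]

theorem mul_le_sq_div_four (r n : ℕ) : r * (n - r) ≤ n ^ 2 / 4 := by
  rw [Nat.le_div_iff_mul_le (by norm_num)]
  rcases le_total r n with h | h
  · obtain ⟨k, rfl⟩ := Nat.exists_eq_add_of_le h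
    simp only [Nat.add_sub_cancel_left]
    zify
    nlinarith [sq_nonneg ((r : ℤ) - k)]
  · simp [Nat.sub_eq_zero_of_le h]

theorem ncard_finrank_eq_of_le (Y : Submodule F W) (r : ℕ) :
    {I : Submodule F W | Y ≤ I ∧ Module.finrank F I = r}.ncard ≤
      q ^ ((r - Module.finrank F Y) * (Module.finrank F W + 1 - r)) := by
  have := Module.finite_of_finite F (M := W)
  by_cases hr : Module.finrank F Y ≤ r
  swap
  · have : {I : Submodule F W | Y ≤ I ∧ Module.finrank F I = r} = ∅ := by
      ext I
      simp only [Set.mem_ofPred_eq, Set.mem_empty_iff_false, iff_false, not_and]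
      intro h
      have := Submodule.finrank_mono h
      omega
    simp [this]
  have h := ncard_finrank_eq_le (F := F) (W := W ⧸ Y) (r - Module.finrank F Y)
  have hq := Submodule.finrank_quotient_add_finrank Y
  have : Finite (Submodule F (W ⧸ Y)) := finite_submodule
  rw [show Module.finrank F (W ⧸ Y) + 1 - (r - Module.finrank F Y) = Module.finrank F W + 1 - r by
    omega] at h
  refine le_trans ?_ h
  refine Set.ncard_le_ncard_of_injOn (fun I => I.map Y.mkQ) ?_ ?_ (Set.toFinite _)
  · rintro I ⟨h1, h2⟩
    have e := finrank_map_add_finrank_inf_ker Y.mkQ I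
    rw [Submodule.ker_mkQ, inf_eq_right.2 h1] at e
    change Module.finrank F (I.map Y.mkQ) = _
    omega
  · rintro I ⟨h1, _⟩ J ⟨h2, _⟩ h
    have h' := congr_arg (Submodule.comap Y.mkQ) h
    simpa [Submodule.comap_map_mkQ, h1, h2] using h'

/-- All savings come from here: each dimension forced into `I` lowers the base of a quadratic
exponent. -/
theorem ncard_submodule_ge_le (Y : Submodule F W) :
    {I : Submodule F W | Y ≤ I}.ncard ≤ (Module.finrank F W + 1) *
      q ^ ((Module.finrank F W + 1 - Module.finrank F Y) ^ 2 / 4) := by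
  have := Module.finite_of_finite F (M := W)
  have : {I : Submodule F W | Y ≤ I} ⊆ ⋃ r ∈ Finset.range (Module.finrank F W + 1),
      {I : Submodule F W | Y ≤ I ∧ Module.finrank F I = r} := by
    intro I hI
    simp only [Set.mem_iUnion, Finset.mem_range]
    exact ⟨_, Nat.lt_succ_of_le (Submodule.finrank_le I), hI, rfl⟩
  refine (Set.ncard_le_ncard this (Set.toFinite _)).trans ?_
  refine (Finset.set_ncard_biUnion_le _ _).trans ?_
  refine (Finset.sum_le_card_nsmul _ _ _ fun r hr => ?_).trans (by rw [Finset.card_range, smul_eq_mul])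
  refine (ncard_finrank_eq_of_le Y r).trans (Nat.pow_le_pow_right Nat.card_pos ?_)
  refine le_trans (le_of_eq ?_) (mul_le_sq_div_four (r - Module.finrank F Y) _)
  have := Submodule.finrank_le Y
  have hr' := Finset.mem_range.1 hr
  rcases le_total r (Module.finrank F Y) with h | h
  · simp [Nat.sub_eq_zero_of_le h]
  · congr 1; omega

/-- Graphs of linear maps between two complementary halves of `W` are already numerous enough. -/
theorem pow_le_card_submodule :
    q ^ (Module.finrank F W ^ 2 / 4) ≤ Nat.card (Submodule F W) := by
  set d := Module.finrank F W with hd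
  have hab : d / 2 + (d - d / 2) = d := by omega
  have e : W ≃ₗ[F] (Fin (d / 2) → F) × (Fin (d - d / 2) → F) :=
    LinearEquiv.ofFinrankEq _ _ (by simp [← hd, hab])
  rw [Nat.card_congr (Submodule.orderIsoMapComap e).toEquiv]
  have : Finite (Submodule F ((Fin (d / 2) → F) × (Fin (d - d / 2) → F))) := finite_submodule
  have h := Nat.card_le_card_of_injective
    (fun f : (Fin (d / 2) → F) →ₗ[F] (Fin (d - d / 2) → F) => f.graph) ?_
  · rw [card_eq_pow (F := F)] at h
    refine (Nat.pow_le_pow_right Nat.card_pos ?_).trans h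
    rw [Module.finrank_linearMap]
    simp only [Module.finrank_fin_fun]
    rw [Nat.div_le_iff_le_mul_add_pred (by norm_num)]
    rcases Nat.even_or_odd' d with ⟨k, hk | hk⟩
    · rw [show d / 2 = k by omega, show d - k = k by omega, hk]; ring_nf; omega
    · rw [show d / 2 = k by omega, show d - k = k + 1 by omega, hk]; ring_nf; omega
  · intro f g h
    refine LinearMap.ext fun y => ?_
    have h1 : (y, f y) ∈ f.graph := by simp
    rw [show f.graph = g.graph from h] at h1
    simpa using h1

omit [Finite F] in
theorem exists_eq_sup_span_range (u : ℕ) : ∀ X I : Submodule F W, X ≤ I →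
    Module.finrank F I ≤ Module.finrank F X + u →
    ∃ x : Fin u → W, (∀ i, x i ∈ I) ∧ I = X ⊔ Submodule.span F (Set.range x) := by
  induction u with
  | zero =>
    intro X I hXI h
    exact ⟨Fin.elim0, fun i => i.elim0, by
      simp [Submodule.eq_of_le_of_finrank_le hXI h]⟩
  | succ u ih =>
    intro X I hXI h
    by_cases hIX : I ≤ X
    · exact ⟨0, fun i => I.zero_mem, le_antisymm (hIX.trans le_sup_left)
        (sup_le hXI (by rw [Submodule.span_le]; rintro _ ⟨i, rfl⟩; exact I.zero_mem))⟩
    · obtain ⟨v, hv, hvX⟩ := SetLike.not_le_iff_exists.1 hIX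
      obtain ⟨x, hx, e⟩ := ih (X ⊔ Submodule.span F {v}) I
        (sup_le hXI (by simpa [Submodule.span_le] using hv))
        (by rw [Submodule.finrank_sup_span_singleton hvX]; omega)
      refine ⟨Fin.cons v x, fun i => Fin.cases hv hx i, ?_⟩
      rw [Fin.range_cons, Submodule.span_insert, ← sup_assoc, ← e]

/-- `I` is recovered from its trace on `Z` and `u` vectors spanning it modulo that trace. -/
theorem ncard_generated_mod_le (Z : Submodule F W) (𝓙 : Set (Submodule F W)) (u : ℕ)
    (h : ∀ I ∈ 𝓙, Module.finrank F I ≤ Module.finrank F (I ⊓ Z : Submodule F W) + u) :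
    𝓙.ncard ≤ q ^ (u * Module.finrank F W) * Nat.card (Submodule F Z) := by
  have := Module.finite_of_finite F (M := W)
  have : Finite (Submodule F Z) := finite_submodule
  have key : ∀ I : 𝓙, ∃ x : Fin u → W,
      I.1 = (I.1 ⊓ Z) ⊔ Submodule.span F (Set.range x) := by
    rintro ⟨I, hI⟩
    obtain ⟨x, -, hx⟩ := exists_eq_sup_span_range u _ I inf_le_left (h I hI)
    exact ⟨x, hx⟩
  choose x hx using key
  have hc : Nat.card ((Fin u → W) × Submodule F Z) =
      q ^ (u * Module.finrank F W) * Nat.card (Submodule F Z) := by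
    rw [Nat.card_prod, Nat.card_fun, card_eq_pow (F := F) (W := W), ← pow_mul, Nat.card_fin,
      mul_comm u]
  rw [← hc, ← Nat.card_coe_set_eq]
  refine Nat.card_le_card_of_injective (fun I : 𝓙 => (x I, I.1.comap Z.subtype)) ?_
  intro I J h
  simp only [Prod.mk.injEq] at h
  obtain ⟨h1, h2⟩ := h
  have h3 := congr_arg (Submodule.map Z.subtype) h2
  rw [Submodule.map_comap_subtype, Submodule.map_comap_subtype, inf_comm, inf_comm Z] at h3
  ext1
  rw [hx I, hx J, h1, h3]

end Counting

/-! ### Subspaces stable under a map far from scalar -/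

section Invariant

variable {F : Type*} [Field F] [Finite F]
variable {W : Type*} [AddCommGroup W] [Module F W] [FiniteDimensional F W]

local notation "q" => Nat.card F

theorem card_submodule_le :
    Nat.card (Submodule F W) ≤ (Module.finrank F W + 1) *
      q ^ ((Module.finrank F W + 1) ^ 2 / 4) := by
  have h := ncard_submodule_ge_le (⊥ : Submodule F W)
  simpa using h

theorem ncard_mul_mul_le {α β : Type*} [Finite α] [Finite β] (S : Set α) (r : α → β → Prop)
    {m k l : ℕ} (hk : 0 < k) (h1 : ∀ a ∈ S, m ≤ {b | r a b}.ncard)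
    (h2 : ∀ b, {a ∈ S | r a b}.ncard * k ≤ l) :
    S.ncard * m * k ≤ Nat.card β * l := by
  have h := ncard_mul_le_card_mul S r h1 fun b => (Nat.le_div_iff_mul_le hk).2 (h2 b)
  calc _ ≤ Nat.card β * (l / k) * k := Nat.mul_le_mul_right _ h
    _ ≤ _ := by rw [mul_assoc]; exact Nat.mul_le_mul_left _ (Nat.div_mul_le_self _ _)

theorem ncard_coe_submodule (I : Submodule F W) : (I : Set W).ncard = q ^ Module.finrank F I := by
  rw [← Nat.card_coe_set_eq]
  exact card_eq_pow (W := I)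

/-- The `r`-dimensional invariant subspaces of `D` on which `D` is far from being scalar. -/
def farFromScalar (D : W →ₗ[F] W) (r u : ℕ) : Set (Submodule F W) :=
  {I | Module.finrank F I = r ∧ (∀ x ∈ I, D x ∈ I) ∧
    ∀ l : F, u ≤ Module.finrank F (I.map (D - l • LinearMap.id))}

/-- The remaining vectors of `I` lie in `B` or in one of the q subspaces I ∩ (D - l)⁻¹B. Each of
these has dimension at most dim B + (r - u) ≤ r - 3, so at most q^(r-3) + q^(r-2) vectors are lost.
-/
theorem pow_le_ncard_extending (D : W →ₗ[F] W) {r u : ℕ} {I B : Submodule F W}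
    (hI : I ∈ farFromScalar D r u) (hB : Module.finrank F B + 3 ≤ u) :
    q ^ (r - 1) ≤ {v | v ∈ I ∧ v ∉ B ∧ D v ∉ B ⊔ Submodule.span F {v}}.ncard := by
  have := Module.finite_of_finite F (M := W)
  have := Fintype.ofFinite F
  obtain ⟨hr, -, hu⟩ := hI
  have hru : u ≤ r := (hu 0).trans (hr ▸ Submodule.finrank_map_le _ _)
  set good := {v | v ∈ I ∧ v ∉ B ∧ D v ∉ B ⊔ Submodule.span F {v}}
  have hcov : (I : Set W) ⊆ good ∪ ((B : Set W) ∪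
      ⋃ l ∈ (Finset.univ : Finset F), (I ⊓ B.comap (D - l • LinearMap.id) : Submodule F W)) := by
    intro v hv
    by_cases h1 : v ∈ B
    · exact Or.inr (Or.inl h1)
    by_cases h2 : D v ∈ B ⊔ Submodule.span F {v}
    · right; right
      obtain ⟨b, hb, w, hw, e⟩ := Submodule.mem_sup.1 h2
      obtain ⟨l, rfl⟩ := Submodule.mem_span_singleton.1 hw
      simp only [Set.mem_iUnion]
      refine ⟨l, Finset.mem_univ _, hv, ?_⟩
      rw [SetLike.mem_coe, Submodule.mem_comap]
      simpa [← e] using hb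
    · exact Or.inl ⟨hv, h1, h2⟩
  have h1 := Set.ncard_le_ncard hcov (Set.toFinite _)
  have h2 := h1.trans (Set.ncard_union_le _ _)
  have h3 := h2.trans (Nat.add_le_add_left (Set.ncard_union_le _ _) _)
  have h4 := h3.trans (Nat.add_le_add_left (Nat.add_le_add_left
    (Finset.set_ncard_biUnion_le _ _) _) _)
  have h5 : ∀ l ∈ (Finset.univ : Finset F),
      ((I ⊓ B.comap (D - l • LinearMap.id) : Submodule F W) : Set W).ncard ≤ q ^ (r - 3) := by
    intro l _
    rw [ncard_coe_submodule]
    refine Nat.pow_le_pow_right Nat.card_pos ?_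
    have e1 := finrank_map_add_finrank_inf_ker (D - l • LinearMap.id)
      (I ⊓ B.comap (D - l • LinearMap.id))
    have e2 := finrank_map_add_finrank_inf_ker (D - l • LinearMap.id) I
    have e3 : Module.finrank F ((I ⊓ B.comap (D - l • LinearMap.id)).map
        (D - l • LinearMap.id)) ≤ Module.finrank F B :=
      Submodule.finrank_mono ((Submodule.map_mono inf_le_right).trans
        (Submodule.map_comap_le _ _))
    have e4 : Module.finrank F (I ⊓ B.comap (D - l • LinearMap.id) ⊓
        LinearMap.ker (D - l • LinearMap.id) : Submodule F W) ≤
        Module.finrank F (I ⊓ LinearMap.ker (D - l • LinearMap.id) : Submodule F W) :=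
      Submodule.finrank_mono (inf_le_inf_right _ inf_le_left)
    have := hu l
    omega
  have h6 := h4.trans (Nat.add_le_add_left (Nat.add_le_add_left
    (Finset.sum_le_card_nsmul _ _ _ h5) _) _)
  rw [ncard_coe_submodule, ncard_coe_submodule, hr, Finset.card_univ, ← Nat.card_eq_fintype_card,
    smul_eq_mul] at h6
  have hq := two_le_card_field (F := F)
  have h7 : q ^ Module.finrank F B ≤ q ^ (r - 3) := Nat.pow_le_pow_right Nat.card_pos (by omega)
  obtain ⟨k, rfl⟩ : ∃ k, r = k + 3 := ⟨r - 3, by omega⟩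
  simp only [Nat.add_sub_cancel, show k + 3 - 1 = k + 2 by omega] at *
  have h8 : q ^ k ≤ q ^ (k + 1) := Nat.pow_le_pow_right Nat.card_pos (by omega)
  have h9 : 2 * q ^ (k + 1) ≤ q ^ (k + 2) := by
    rw [pow_succ q (k + 1), mul_comm]; gcongr
  have h10 : 2 * q ^ (k + 2) ≤ q ^ (k + 3) := by
    rw [pow_succ q (k + 2), mul_comm]; gcongr
  have h11 : q * q ^ k = q ^ (k + 1) := by rw [pow_succ, mul_comm]
  omega

/-- Double counting of pairs (I, v), iterated `s` times. Each round pays q^(dim W) for the choice of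
v and regains q^(r-1) for the good v in `I`; as `I` also contains D v, the subspace `B` grows by two
dimensions for the price of one. -/
theorem ncard_farFromScalar_ge (D : W →ₗ[F] W) (r u : ℕ) (s : ℕ) : ∀ B : Submodule F W,
    Module.finrank F B + 2 * s + 3 ≤ u →
    {I ∈ farFromScalar D r u | B ≤ I}.ncard * q ^ ((r - 1) * s) ≤
      q ^ (Module.finrank F W * s) *
        q ^ ((r - Module.finrank F B - 2 * s) * (Module.finrank F W + 1 - r)) := by
  have := Module.finite_of_finite F (M := W)
  induction s with
  | zero =>
    intro B _
    simp only [mul_zero, pow_zero, mul_one, one_mul, Nat.sub_zero]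
    refine (Set.ncard_le_ncard ?_ (Set.toFinite _)).trans (ncard_finrank_eq_of_le B r)
    rintro I ⟨h1, h2⟩
    exact ⟨h2, h1.1⟩
  | succ s ih =>
    intro B hB
    have key := ncard_mul_mul_le {I ∈ farFromScalar D r u | B ≤ I}
      (fun I v => v ∈ I ∧ v ∉ B ∧ D v ∉ B ⊔ Submodule.span F {v})
      (m := q ^ (r - 1)) (k := q ^ ((r - 1) * s)) (l := q ^ (Module.finrank F W * s) *
        q ^ ((r - Module.finrank F B - 2 * (s + 1)) * (Module.finrank F W + 1 - r)))
      (pow_pos Nat.card_pos _) ?_ ?_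
    · rw [card_eq_pow (F := F) (W := W), ← mul_assoc, ← pow_add, mul_assoc, ← pow_add] at key
      convert key using 3 <;> ring
    · rintro I ⟨hI, -⟩
      exact pow_le_ncard_extending D hI (by omega)
    · intro v
      by_cases hv : v ∉ B ∧ D v ∉ B ⊔ Submodule.span F {v}
      swap
      · have : {I ∈ {I ∈ farFromScalar D r u | B ≤ I} |
            v ∈ I ∧ v ∉ B ∧ D v ∉ B ⊔ Submodule.span F {v}} = ∅ := by
          ext I
          simp only [Set.mem_ofPred_eq, Set.mem_empty_iff_false, iff_false]
          exact fun h => hv h.2.2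
        rw [this]
        simp
      · have e : Module.finrank F (B ⊔ Submodule.span F {v} ⊔ Submodule.span F {D v} :
            Submodule F W) = Module.finrank F B + 2 := by
          rw [Submodule.finrank_sup_span_singleton hv.2, Submodule.finrank_sup_span_singleton hv.1]
        have h := ih (B ⊔ Submodule.span F {v} ⊔ Submodule.span F {D v}) (by omega)
        rw [e, show r - (Module.finrank F B + 2) - 2 * s = r - Module.finrank F B - 2 * (s + 1) by
          omega] at h
        refine le_trans (Nat.mul_le_mul_right _ (Set.ncard_le_ncard ?_ (Set.toFinite _))) h
        rintro I ⟨⟨h1, h2⟩, h3, -⟩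
        refine ⟨h1, sup_le (sup_le h2 ?_) ?_⟩
        · simpa [Submodule.span_le] using h3
        · simpa [Submodule.span_le] using h1.2.1 v h3

/-- With m = dim W the exponents combine to (m+1-r)s + (r-2s)(m+1-r) = (r-s)((m+1-s) - (r-s)), a
product of two numbers with sum m+1-s. -/
theorem ncard_farFromScalar_le (D : W →ₗ[F] W) (r s : ℕ) :
    (farFromScalar D r (2 * s + 3)).ncard ≤ q ^ ((Module.finrank F W + 1 - s) ^ 2 / 4) := by
  have := Module.finite_of_finite F (M := W)
  rcases (farFromScalar D r (2 * s + 3)).eq_empty_or_nonempty with h | ⟨I, hI⟩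
  · simp [h]
  have hr : r ≤ Module.finrank F W := hI.1 ▸ Submodule.finrank_le I
  have hur : 2 * s + 3 ≤ r := (hI.2.2 0).trans (hI.1 ▸ Submodule.finrank_map_le _ _)
  have key := ncard_farFromScalar_ge D r (2 * s + 3) s ⊥ (by simp)
  simp only [bot_le, and_true, Set.ofPred_mem_eq, finrank_bot, Nat.sub_zero] at key
  refine le_trans ?_ (Nat.pow_le_pow_right Nat.card_pos (mul_le_sq_div_four (r - s) _))
  refine le_of_mul_le_mul_right (key.trans (le_of_eq ?_)) (pow_pos Nat.card_pos ((r - 1) * s))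
  rw [← pow_add, ← pow_add]
  congr 1
  obtain ⟨a, ha⟩ := Nat.exists_eq_add_of_le hur
  obtain ⟨b, hb⟩ := Nat.exists_eq_add_of_le hr
  rw [hb, show r + b + 1 - s - (r - s) = b + 1 by omega, show r + b + 1 - r = b + 1 by omega,
    show r - 1 = 2 * s + 2 + a by omega, show r - 2 * s = a + 3 by omega,
    show r - s = s + 3 + a by omega, ha]
  ring

/-- Either `I` is far from scalar, or some (D - l)I has dimension below 2s+3. In the second case `I`
is given by 2s+3 vectors and a subspace of ker(D - l), whose codimension is at least `e`. -/
theorem ncard_invariant_le (D : W →ₗ[F] W) (s e : ℕ)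
    (h : ∀ l : F, e ≤ Module.finrank F (LinearMap.range (D - l • LinearMap.id))) :
    {I : Submodule F W | ∀ x ∈ I, D x ∈ I}.ncard ≤
      (Module.finrank F W + 1) * q ^ ((Module.finrank F W + 1 - s) ^ 2 / 4) +
      q * (q ^ ((2 * s + 3) * Module.finrank F W) *
        ((Module.finrank F W + 1) * q ^ ((Module.finrank F W + 1 - e) ^ 2 / 4))) := by
  have := Module.finite_of_finite F (M := W)
  have := Fintype.ofFinite F
  have hcov : {I : Submodule F W | ∀ x ∈ I, D x ∈ I} ⊆
      (⋃ r ∈ Finset.range (Module.finrank F W + 1), farFromScalar D r (2 * s + 3)) ∪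
      ⋃ l ∈ (Finset.univ : Finset F), {I : Submodule F W |
        Module.finrank F (I.map (D - l • LinearMap.id)) < 2 * s + 3} := by
    intro I hI
    by_cases h1 : ∀ l : F, 2 * s + 3 ≤ Module.finrank F (I.map (D - l • LinearMap.id))
    · left
      simp only [Set.mem_iUnion, Finset.mem_range]
      exact ⟨_, Nat.lt_succ_of_le (Submodule.finrank_le I), rfl, hI, h1⟩
    · right
      push Not at h1
      simpa only [Set.mem_iUnion, Finset.mem_univ, exists_prop, true_and, Set.mem_ofPred_eq] using h1
  refine (Set.ncard_le_ncard hcov (Set.toFinite _)).trans ((Set.ncard_union_le _ _).trans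
    (Nat.add_le_add ?_ ?_))
  · refine (Finset.set_ncard_biUnion_le _ _).trans ?_
    refine (Finset.sum_le_card_nsmul _ _ _ fun r _ => ncard_farFromScalar_le D r s).trans ?_
    rw [Finset.card_range, smul_eq_mul]
  · refine (Finset.set_ncard_biUnion_le _ _).trans ?_
    refine (Finset.sum_le_card_nsmul _ _ _ fun l _ => ?_).trans (le_of_eq (by
      rw [Finset.card_univ, ← Nat.card_eq_fintype_card, smul_eq_mul]))
    refine (ncard_generated_mod_le (LinearMap.ker (D - l • LinearMap.id)) _ (2 * s + 3)
      fun I hI => ?_).trans (Nat.mul_le_mul_left _ (card_submodule_le.trans ?_))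
    · have e1 := finrank_map_add_finrank_inf_ker (D - l • LinearMap.id) I
      rw [Set.mem_ofPred_eq] at hI
      omega
    · have e1 := (D - l • LinearMap.id).finrank_range_add_finrank_ker
      have e2 := h l
      gcongr
      · exact Submodule.finrank_le _
      · exact Nat.card_pos
      · omega

/-- Bound for the number of subspaces that are stable under a linear relation far from being
scalar. -/
theorem ncard_stable_le {T : Type*} [AddCommGroup T] [Module F T] (p h : T →ₗ[F] W)
    (hp : Function.Surjective p) (s e : ℕ)
    (he : ∀ l : F, e + (2 * s + 3) ≤ Module.finrank F (LinearMap.range (h - l • p))) :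
    {I : Submodule F W | ∀ t, p t ∈ I → h t ∈ I}.ncard ≤
      (Module.finrank F W + 1) * q ^ ((Module.finrank F W + 1 - s) ^ 2 / 4) +
      q * (q ^ ((2 * s + 3) * Module.finrank F W) *
        ((Module.finrank F W + 1) * q ^ ((Module.finrank F W + 1 - e) ^ 2 / 4))) := by
  have := Module.finite_of_finite F (M := W)
  -- Stability at p t = 0 puts h(ker p) inside every such `I`. If this image is large, it alone
  -- gives the bound; otherwise a section of `p` turns the relation into a map at the cost of fewer
  -- than `s` in rank.
  by_cases hK : s ≤ Module.finrank F ((LinearMap.ker p).map h)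
  · refine le_trans ?_ (Nat.le_add_right _ _)
    refine (Set.ncard_le_ncard (t := {I | (LinearMap.ker p).map h ≤ I}) ?_ (Set.toFinite _)).trans
      ((ncard_submodule_ge_le _).trans ?_)
    · intro I hI
      rw [Set.mem_ofPred_eq, Submodule.map_le_iff_le_comap]
      intro t ht
      exact hI t (by rw [LinearMap.mem_ker.1 ht]; exact I.zero_mem)
    · gcongr
      exact Nat.card_pos
  · push Not at hK
    obtain ⟨σ, hσ⟩ := p.exists_rightInverse_of_surjective (LinearMap.range_eq_top.2 hp)
    have hσ' : ∀ x, p (σ x) = x := fun x => LinearMap.congr_fun hσ x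
    refine (Set.ncard_le_ncard ?_ (Set.toFinite _)).trans
      (ncard_invariant_le (h ∘ₗ σ) s e fun l => ?_)
    · intro I hI x hx
      exact hI (σ x) (by rwa [hσ'])
    · have hle : LinearMap.range (h - l • p) ≤
          LinearMap.range (h ∘ₗ σ - l • LinearMap.id) ⊔ (LinearMap.ker p).map h := by
        rintro _ ⟨t, rfl⟩
        refine Submodule.mem_sup.2 ⟨_, ⟨p t, rfl⟩, h (t - σ (p t)), ⟨_, ?_, rfl⟩, ?_⟩
        · simp [hσ']
        · simp
      have h1 := he l
      have h2 := Submodule.finrank_mono hle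
      have h3 := Submodule.finrank_add_le_finrank_add_finrank
        (LinearMap.range (h ∘ₗ σ - l • LinearMap.id)) ((LinearMap.ker p).map h)
      omega

end Invariant

/-! ### Powers of an algebra and skew derivations -/

section Powers

variable {F : Type*} [Field F]
variable {A : Type*} [NonUnitalNonAssocRing A] [Module F A]
variable {B : Type*} [NonUnitalNonAssocRing B] [Module F B]

theorem map_freeMagma_lift {X : Type*} {M N : Type*} [Mul M] [Mul N] (φ : M →ₙ* N) (f : X → M)
    (w : FreeMagma X) : φ (FreeMagma.lift f w) = FreeMagma.lift (fun x => φ (f x)) w := by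
  induction w with
  | ih1 x => simp
  | ih2 x y hx hy => simp [hx, hy]

theorem lift_mem_power {X : Type*} (f : X → A) (w : FreeMagma X) :
    FreeMagma.lift f w ∈ power F A w.length := by
  have h : ∀ w : FreeMagma X, (FreeMagma.map f w).length = w.length := by
    intro w
    induction w with
    | ih1 x => simp
    | ih2 x y hx hy => simp [hx, hy]
  refine Submodule.subset_span ⟨FreeMagma.map f w, h w, ?_⟩
  induction w with
  | ih1 x => simp
  | ih2 x y hx hy => simp [hx, hy]

theorem power_one : power F A 1 = ⊤ :=
  eq_top_iff.2 fun x _ => by simpa using lift_mem_power (F := F) (fun _ : Unit => x) (FreeMagma.of ())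

variable [IsScalarTower F A A] [SMulCommClass F A A]

theorem mul_mem_power {i j : ℕ} {x y : A} (hx : x ∈ power F A i) (hy : y ∈ power F A j) :
    x * y ∈ power F A (i + j) := by
  induction hx using Submodule.span_induction with
  | mem x hx =>
    obtain ⟨w, rfl, rfl⟩ := hx
    induction hy using Submodule.span_induction with
    | mem y hy =>
      obtain ⟨w', rfl, rfl⟩ := hy
      simpa using lift_mem_power (F := F) (id : A → A) (w * w')
    | zero => simp
    | add y z _ _ h1 h2 => rw [mul_add]; exact add_mem h1 h2
    | smul a y _ h => rw [mul_smul_comm]; exact Submodule.smul_mem _ _ h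
  | zero => simp
  | add y z _ _ h1 h2 => rw [add_mul]; exact add_mem h1 h2
  | smul a y _ h => rw [smul_mul_assoc]; exact Submodule.smul_mem _ _ h

/-- `power` uses monomials of exact degree, so that powers decrease is not formal: surplus length is
absorbed by regarding a subword as an element of lower degree. -/
theorem lift_mem_power_of_le (w : FreeMagma A) :
    ∀ i, 1 ≤ i → i ≤ w.length → FreeMagma.lift id w ∈ power F A i := by
  induction w with
  | ih1 x =>
    intro i h1 h2
    obtain rfl : i = 1 := le_antisymm (by simpa using h2) h1
    rw [power_one]; trivial
  | ih2 x y hx hy =>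
    intro i h1 h2
    simp only [map_mul]
    rcases eq_or_lt_of_le h1 with rfl | h1
    · rw [power_one]; trivial
    have px := x.length_pos
    have py := y.length_pos
    have h2 : i ≤ x.length + y.length := h2
    rcases le_or_gt i x.length with h | h
    · have := mul_mem_power (hx (i - 1) (by omega) (by omega)) (hy 1 le_rfl py)
      rwa [Nat.sub_add_cancel h1.le] at this
    · have := mul_mem_power (hx x.length px le_rfl) (hy (i - x.length) (by omega) (by omega))
      rwa [Nat.add_sub_cancel' h.le] at this

theorem power_antitone {i j : ℕ} (hi : 1 ≤ i) (hij : i ≤ j) : power F A j ≤ power F A i := by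
  rw [power, Submodule.span_le]
  rintro _ ⟨w, rfl, rfl⟩
  exact lift_mem_power_of_le w i hi hij

theorem mul_mem_power_two (x y : A) : x * y ∈ power F A 2 :=
  mul_mem_power (i := 1) (j := 1) (by rw [power_one]; trivial) (by rw [power_one]; trivial)

omit [IsScalarTower F A A] [SMulCommClass F A A] in
theorem map_mem_power (φ : A →ₙₐ[F] B) {i : ℕ} {x : A} (hx : x ∈ power F A i) :
    φ x ∈ power F B i := by
  induction hx using Submodule.span_induction with
  | mem x hx =>
    obtain ⟨w, rfl, rfl⟩ := hx
    have := map_freeMagma_lift (φ : A →ₙ* B) id w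
    rw [show φ (FreeMagma.lift id w) = (φ : A →ₙ* B) (FreeMagma.lift id w) from rfl, this]
    exact lift_mem_power _ w
  | zero => simp
  | add y z _ _ h1 h2 => rw [map_add]; exact add_mem h1 h2
  | smul a y _ h => rw [map_smul]; exact Submodule.smul_mem _ _ h

omit [IsScalarTower F A A] [SMulCommClass F A A] in
theorem exists_mem_power (φ : A →ₙₐ[F] B) (hφ : Function.Surjective φ) {i : ℕ} {y : B}
    (hy : y ∈ power F B i) : ∃ x ∈ power F A i, φ x = y := by
  induction hy using Submodule.span_induction with
  | mem y hy =>
    obtain ⟨w, rfl, rfl⟩ := hy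
    refine ⟨FreeMagma.lift (Function.surjInv hφ) w, lift_mem_power _ w, ?_⟩
    have := map_freeMagma_lift (φ : A →ₙ* B) (Function.surjInv hφ) w
    rw [show φ (FreeMagma.lift (Function.surjInv hφ) w) =
      (φ : A →ₙ* B) (FreeMagma.lift (Function.surjInv hφ) w) from rfl, this]
    congr 2
    funext b
    exact Function.surjInv_eq hφ b
  | zero => exact ⟨0, zero_mem _, map_zero _⟩
  | add y z _ _ h1 h2 =>
    obtain ⟨a, ha, rfl⟩ := h1
    obtain ⟨b, hb, rfl⟩ := h2
    exact ⟨a + b, add_mem ha hb, map_add _ _ _⟩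
  | smul r y _ h =>
    obtain ⟨a, ha, rfl⟩ := h
    exact ⟨r • a, Submodule.smul_mem _ _ ha, map_smul _ _ _⟩

omit [IsScalarTower F A A] [SMulCommClass F A A] in
/-- A skew derivation with values in `B ^ 2` raises the degree of powers. -/
theorem skewDerivation_mem_power [IsScalarTower F B B] [SMulCommClass F B B]
    (τ : A →ₗ[F] B) (ρ ρ' : A →ₙₐ[F] B)
    (hτ : ∀ x y, τ (x * y) = τ x * ρ y + ρ' x * τ y) (h2 : ∀ x, τ x ∈ power F B 2)
    {i : ℕ} {x : A} (hx : x ∈ power F A i) : τ x ∈ power F B (i + 1) := by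
  induction hx using Submodule.span_induction with
  | mem x hx =>
    obtain ⟨w, rfl, rfl⟩ := hx
    induction w with
    | ih1 x => exact h2 x
    | ih2 x y hx hy =>
      rw [map_mul, hτ]
      refine add_mem ?_ ?_
      · have := mul_mem_power hx (map_mem_power ρ (lift_mem_power (F := F) (id : A → A) y))
        convert this using 2
        simp only [FreeMagma.length]; omega
      · have := mul_mem_power (map_mem_power ρ' (lift_mem_power (F := F) (id : A → A) x)) hy
        convert this using 2
        simp only [FreeMagma.length]; omega
  | zero => simp
  | add y z _ _ h1 h2 => rw [map_add]; exact add_mem h1 h2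
  | smul a y _ h => rw [map_smul]; exact Submodule.smul_mem _ _ h

end Powers

/-! ### The absolutely free algebra and its derivations -/

section Free

variable {F : Type u} [Field F] {X : Type v}

local notation "𝔸" => FreeNonUnitalNonAssocAlgebra F X

theorem span_range_word :
    Submodule.span F (Set.range (FreeMagma.lift (FreeNonUnitalNonAssocAlgebra.of F) :
      FreeMagma X → 𝔸)) = ⊤ := by
  refine eq_top_iff.2 fun a _ => ?_
  induction a using MonoidAlgebra.induction_linear with
  | zero => exact zero_mem _
  | add x y hx hy => exact add_mem (hx trivial) (hy trivial)
  | single w r =>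
    have h : ∀ w : FreeMagma X, (FreeMagma.lift (FreeNonUnitalNonAssocAlgebra.of F) w : 𝔸) =
        MonoidAlgebra.single w 1 := by
      intro w
      induction w with
      | ih1 x => rfl
      | ih2 x y hx hy => rw [map_mul, hx, hy, MonoidAlgebra.single_mul_single, one_mul]
    have e : MonoidAlgebra.single w r =
        r • (FreeMagma.lift (FreeNonUnitalNonAssocAlgebra.of F) w : 𝔸) := by
      rw [h, MonoidAlgebra.smul_single, smul_eq_mul, mul_one]
    rw [e]
    exact Submodule.smul_mem _ _ (Submodule.subset_span ⟨w, rfl⟩)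

theorem free_induction {p : 𝔸 → Prop} (of : ∀ x, p (FreeNonUnitalNonAssocAlgebra.of F x))
    (mul : ∀ a b, p a → p b → p (a * b)) (zero : p 0) (add : ∀ a b, p a → p b → p (a + b))
    (smul : ∀ (r : F) a, p a → p (r • a)) (a : 𝔸) : p a := by
  have ha : a ∈ Submodule.span F (Set.range (FreeMagma.lift
      (FreeNonUnitalNonAssocAlgebra.of F) : FreeMagma X → 𝔸)) := by
    rw [span_range_word]; trivial
  induction ha using Submodule.span_induction with
  | mem x hx =>
    obtain ⟨w, rfl⟩ := hx
    induction w with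
    | ih1 x => exact of x
    | ih2 x y hx hy => rw [map_mul]; exact mul _ _ hx hy
  | zero => exact zero
  | add y z _ _ h1 h2 => exact add _ _ h1 h2
  | smul a y _ h => exact smul _ _ h

/-- Every map from the generators of a free algebra extends to a derivation. -/
theorem exists_derivation (δ : X → 𝔸) : ∃ D : 𝔸 →ₗ[F] 𝔸,
    IsDerivation F 𝔸 D ∧ ∀ x, D (FreeNonUnitalNonAssocAlgebra.of F x) = δ x := by
  -- The homomorphism a ↦ !![a, D a; 0, a]: the corner entry of a product of two such matrices is
  -- the Leibniz rule.
  let Φ : 𝔸 →ₙₐ[F] Matrix (Fin 2) (Fin 2) 𝔸 := FreeNonUnitalNonAssocAlgebra.lift F fun x =>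
    !![FreeNonUnitalNonAssocAlgebra.of F x, δ x; 0, FreeNonUnitalNonAssocAlgebra.of F x]
  have hΦ : ∀ a, Φ a 0 0 = a ∧ Φ a 1 0 = 0 ∧ Φ a 1 1 = a := by
    intro a
    induction a using free_induction with
    | of x => simp [Φ]
    | mul a b ha hb => simp [Matrix.mul_apply, ha, hb]
    | zero => simp
    | add a b ha hb => simp [ha, hb]
    | smul r a ha => simp [ha]
  refine ⟨{ toFun := fun a => Φ a 0 1, map_add' := by simp, map_smul' := by simp }, ?_, ?_⟩
  · intro a b
    simp only [LinearMap.coe_mk, AddHom.coe_mk, map_mul, Matrix.mul_apply, Fin.sum_univ_two,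
      (hΦ a).1, (hΦ b).2.2]
    abel
  · intro x
    simp [Φ]

theorem free_skewDerivation_mem_power {B : Type*} [NonUnitalNonAssocRing B] [Module F B]
    [IsScalarTower F B B] [SMulCommClass F B B] (τ : 𝔸 →ₗ[F] B) (ρ ρ' : 𝔸 →ₙₐ[F] B)
    (hτ : ∀ x y, τ (x * y) = τ x * ρ y + ρ' x * τ y)
    (h2 : ∀ x, τ (FreeNonUnitalNonAssocAlgebra.of F x) ∈ power F B 2)
    {i : ℕ} {x : 𝔸} (hx : x ∈ power F 𝔸 i) : τ x ∈ power F B (i + 1) := by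
  refine skewDerivation_mem_power τ ρ ρ' hτ (fun a => ?_) hx
  induction a using free_induction with
  | of x => exact h2 x
  | mul a b _ _ => rw [hτ]; exact add_mem (mul_mem_power_two _ _) (mul_mem_power_two _ _)
  | zero => simp
  | add a b ha hb => rw [map_add]; exact add_mem ha hb
  | smul r a ha => rw [map_smul]; exact Submodule.smul_mem _ _ ha

end Free

/-! ### Multilinear words -/

section Words

/-- The number of occurrences of the letter `i` in a word. -/
def occ (i : ℕ) : FreeMagma ℕ → ℕ
  | FreeMagma.of j => if j = i then 1 else 0
  | x * y => occ i x + occ i y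

theorem occ_of (i j : ℕ) : occ i (FreeMagma.of j) = if j = i then 1 else 0 := rfl

theorem occ_mul (i : ℕ) (x y : FreeMagma ℕ) : occ i (x * y) = occ i x + occ i y := rfl

theorem lift_congr_of_occ {M : Type*} [Mul M] {f g : ℕ → M} (w : FreeMagma ℕ) :
    (∀ i, occ i w ≠ 0 → f i = g i) → FreeMagma.lift f w = FreeMagma.lift g w := by
  induction w with
  | ih1 j => intro h; simpa using h j (by simp [occ_of])
  | ih2 x y hx hy =>
    intro h
    rw [map_mul, map_mul, hx fun i hi => h i (by rw [occ_mul]; omega),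
      hy fun i hi => h i (by rw [occ_mul]; omega)]

theorem lift_eq_zero_of_occ {A : Type*} [NonUnitalNonAssocRing A] {f : ℕ → A} {i : ℕ}
    (hf : f i = 0) (w : FreeMagma ℕ) : occ i w ≠ 0 → FreeMagma.lift f w = 0 := by
  induction w with
  | ih1 j =>
    intro h
    obtain rfl : j = i := by
      by_contra hne
      simp [occ_of, hne] at h
    simpa using hf
  | ih2 x y hx hy =>
    intro h
    rw [map_mul]
    rcases Nat.eq_zero_or_pos (occ i x) with h0 | h0
    · rw [hy (by rw [occ_mul, h0] at h; omega), mul_zero]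
    · rw [hx h0.ne', zero_mul]

/-- Every word is a specialization of a word with pairwise distinct letters. -/
theorem exists_multilinear_word {M : Type*} [Mul M] (u : FreeMagma M) : ∀ k : ℕ,
    ∃ (w : FreeMagma ℕ) (f : ℕ → M), FreeMagma.lift f w = FreeMagma.lift id u ∧
      w.length = u.length ∧
      ∀ i, occ i w = if k ≤ i ∧ i < k + u.length then 1 else 0 := by
  induction u with
  | ih1 x =>
    intro k
    refine ⟨FreeMagma.of k, fun _ => x, rfl, rfl, fun i => ?_⟩
    rw [occ_of]
    simp only [FreeMagma.length]
    grind
  | ih2 x y hx hy =>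
    intro k
    obtain ⟨w1, f1, e1, l1, o1⟩ := hx k
    obtain ⟨w2, f2, e2, l2, o2⟩ := hy (k + x.length)
    refine ⟨w1 * w2, fun i => if i < k + x.length then f1 i else f2 i, ?_, ?_, fun i => ?_⟩
    · rw [map_mul, map_mul, ← e1, ← e2]
      congr 1
      · refine lift_congr_of_occ w1 fun i hi => ?_
        rw [o1 i] at hi
        rw [if_pos]
        by_contra hcon
        exact hi (if_neg fun h => hcon h.2)
      · refine lift_congr_of_occ w2 fun i hi => ?_
        rw [o2 i] at hi
        rw [if_neg]
        intro hcon
        exact hi (if_neg fun h => absurd h.1 (by omega))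
    · simp [FreeMagma.length, l1, l2]
    · rw [occ_mul, o1, o2]
      simp only [FreeMagma.length]
      grind

/-- If `ρ` kills the value of a letter occurring exactly once, then applying `ρ` after a derivation
amounts to replacing this letter by its derivative. -/
theorem hom_derivation_lift {F A B : Type*} [Field F] [NonUnitalNonAssocRing A] [Module F A]
    [NonUnitalNonAssocRing B] [Module F B] (ρ : A →ₙₐ[F] B) (D : A →ₗ[F] A)
    (hD : IsDerivation F A D) {a : ℕ → A} {i : ℕ} (hi : ρ (a i) = 0) (w : FreeMagma ℕ) :
    occ i w = 1 → ρ (D (FreeMagma.lift a w)) =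
      FreeMagma.lift (Function.update (fun j => ρ (a j)) i (ρ (D (a i)))) w := by
  have hlift : ∀ w, ρ (FreeMagma.lift a w) = FreeMagma.lift (fun j => ρ (a j)) w :=
    fun w => map_freeMagma_lift (ρ : A →ₙ* B) a w
  have hcongr : ∀ w, occ i w = 0 → FreeMagma.lift (fun j => ρ (a j)) w =
      FreeMagma.lift (Function.update (fun j => ρ (a j)) i (ρ (D (a i)))) w := by
    intro w h0
    refine lift_congr_of_occ w fun j hj => ?_
    rw [Function.update_of_ne]
    rintro rfl
    exact hj h0
  induction w with
  | ih1 j =>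
    intro h
    obtain rfl : j = i := by
      by_contra hne
      simp [occ_of, hne] at h
    simp
  | ih2 x y hx hy =>
    intro h
    rw [occ_mul] at h
    rw [map_mul, hD, map_add, map_mul, map_mul, map_mul]
    -- In one of the two Leibniz terms `D` misses the factor containing the letter `i`; that term is
    -- killed by ρ (a i) = 0.
    rcases Nat.eq_zero_or_pos (occ i x) with h0 | h0
    · have hy1 : occ i y = 1 := by omega
      rw [hy hy1, hlift y, lift_eq_zero_of_occ (f := fun j => ρ (a j)) hi y (by omega), mul_zero, zero_add, hlift x,
        hcongr x h0]
    · have hy0 : occ i y = 0 := by omega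
      rw [hx (by omega), hlift x, lift_eq_zero_of_occ (f := fun j => ρ (a j)) hi x (by omega), zero_mul, add_zero, hlift y,
        hcongr y hy0]

end Words

/-! ### Homomorphisms and quotient algebras -/

section QuotientHoms

variable {F : Type u} [Field F] {A : Type v} [NonUnitalNonAssocRing A] [Module F A]
variable {B : Type*} [NonUnitalNonAssocRing B] [Module F B]

/-- The projection onto a quotient algebra as a homomorphism. -/
def AlgIdeal.projHom (I : AlgIdeal F A) : A →ₙₐ[F] I.Quot :=
  { I.proj with
    map_zero' := map_zero I.proj
    map_mul' := I.proj_mul }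

theorem AlgIdeal.projHom_surjective (I : AlgIdeal F A) : Function.Surjective I.projHom :=
  I.proj_surjective

theorem AlgIdeal.projHom_eq_zero (I : AlgIdeal F A) {x : A} :
    I.projHom x = 0 ↔ x ∈ I.toSubmodule := by
  have h := I.proj_eq (x := x) (y := 0)
  rw [map_zero, sub_zero] at h
  exact h

/-- A homomorphism vanishing on an ideal factors through the quotient algebra. -/
def AlgIdeal.liftHom (I : AlgIdeal F A) (φ : A →ₙₐ[F] B) (h : ∀ x ∈ I.toSubmodule, φ x = 0) :
    I.Quot →ₙₐ[F] B :=
  { I.toSubmodule.liftQ (φ : A →ₗ[F] B) h with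
    map_zero' := map_zero (I.toSubmodule.liftQ (φ : A →ₗ[F] B) h)
    map_mul' := by
      intro x y
      obtain ⟨x, rfl⟩ := I.proj_surjective x
      obtain ⟨y, rfl⟩ := I.proj_surjective y
      exact map_mul φ x y }

/-- The kernel of a homomorphism as an ideal. -/
def kerIdeal (φ : A →ₙₐ[F] B) : AlgIdeal F A where
  toSubmodule := LinearMap.ker (φ : A →ₗ[F] B)
  mul_left_mem := by
    intro a x hx
    have hx : φ x = 0 := hx
    change φ (a * x) = 0
    rw [map_mul, hx, mul_zero]
  mul_right_mem := by
    intro a x hx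
    have hx : φ x = 0 := hx
    change φ (x * a) = 0
    rw [map_mul, hx, zero_mul]

theorem mem_kerIdeal (φ : A →ₙₐ[F] B) {x : A} : x ∈ (kerIdeal φ).toSubmodule ↔ φ x = 0 := Iff.rfl

theorem InClass.of_surjective [IsScalarTower F A A] [SMulCommClass F A A]
    [IsScalarTower F B B] [SMulCommClass F B B] {V : Set (FreeNonUnitalNonAssocAlgebra F ℕ)}
    (h : InClass F A V) (φ : A →ₙₐ[F] B) (hφ : Function.Surjective φ) : InClass F B V := by
  intro w hw b
  have e : FreeNonUnitalNonAssocAlgebra.lift F b =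
      φ.comp (FreeNonUnitalNonAssocAlgebra.lift F fun i => Function.surjInv hφ (b i)) := by
    refine FreeNonUnitalNonAssocAlgebra.hom_ext F fun i => ?_
    simp only [NonUnitalAlgHom.comp_apply, FreeNonUnitalNonAssocAlgebra.lift_of_apply,
      Function.surjInv_eq hφ]
  rw [e, NonUnitalAlgHom.comp_apply, h w hw, map_zero]

end QuotientHoms

/-! ### Relatively free algebras -/

section RelFree

variable {F : Type u} [Field F] {V : Set (FreeNonUnitalNonAssocAlgebra F ℕ)} {n : ℕ}

/-- The projection of the absolutely free algebra onto the relatively free one. -/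
noncomputable def relProj (V : Set (FreeNonUnitalNonAssocAlgebra F ℕ)) (n : ℕ) :
    FreeNonUnitalNonAssocAlgebra F (Fin n) →ₙₐ[F] RelFree V n :=
  (verbalIdeal V (FreeNonUnitalNonAssocAlgebra F (Fin n))).projHom

theorem relProj_surjective : Function.Surjective (relProj V n) :=
  (verbalIdeal V (FreeNonUnitalNonAssocAlgebra F (Fin n))).projHom_surjective

/-- The free generators of the relatively free algebra. -/
noncomputable def gen (V : Set (FreeNonUnitalNonAssocAlgebra F ℕ)) {n : ℕ} (i : Fin n) : RelFree V n :=
  relProj V n (FreeNonUnitalNonAssocAlgebra.of F i)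

theorem inClass_relFree : InClass F (RelFree V n) V := by
  intro w hw b
  have e : FreeNonUnitalNonAssocAlgebra.lift F b =
      (relProj V n).comp (FreeNonUnitalNonAssocAlgebra.lift F
        fun i => Function.surjInv relProj_surjective (b i)) := by
    refine FreeNonUnitalNonAssocAlgebra.hom_ext F fun i => ?_
    simp only [NonUnitalAlgHom.comp_apply, FreeNonUnitalNonAssocAlgebra.lift_of_apply,
      Function.surjInv_eq relProj_surjective]
  rw [e, NonUnitalAlgHom.comp_apply]
  refine (AlgIdeal.projHom_eq_zero _).2 ((Submodule.mem_sInf).2 fun J hJ => hJ.1 w hw _)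

variable {P : Type v} [NonUnitalNonAssocRing P] [Module F P] [IsScalarTower F P P]
  [SMulCommClass F P P]

theorem lift_eq_zero_of_mem_verbalIdeal (hP : InClass F P V) (f : Fin n → P)
    (x : FreeNonUnitalNonAssocAlgebra F (Fin n))
    (hx : x ∈ (verbalIdeal V (FreeNonUnitalNonAssocAlgebra F (Fin n))).toSubmodule) :
    FreeNonUnitalNonAssocAlgebra.lift F f x = 0 := by
  have hx := (Submodule.mem_sInf).1 hx
    (kerIdeal (FreeNonUnitalNonAssocAlgebra.lift F f)).toSubmodule
  refine (mem_kerIdeal _).1 (hx ⟨fun w hw a => ?_, fun a y hy => ?_⟩)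
  · rw [mem_kerIdeal]
    have e : (FreeNonUnitalNonAssocAlgebra.lift F f).comp (FreeNonUnitalNonAssocAlgebra.lift F a) =
        FreeNonUnitalNonAssocAlgebra.lift F
          fun i => FreeNonUnitalNonAssocAlgebra.lift F f (a i) := by
      refine FreeNonUnitalNonAssocAlgebra.hom_ext F fun i => ?_
      simp only [NonUnitalAlgHom.comp_apply, FreeNonUnitalNonAssocAlgebra.lift_of_apply]
    rw [← NonUnitalAlgHom.comp_apply, e, hP w hw]
  · exact ⟨(kerIdeal _).mul_left_mem a hy, (kerIdeal _).mul_right_mem a hy⟩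

/-- The universal property of relatively free algebras. -/
noncomputable def relLift (hP : InClass F P V) (f : Fin n → P) : RelFree V n →ₙₐ[F] P :=
  AlgIdeal.liftHom _ (FreeNonUnitalNonAssocAlgebra.lift F f)
    (lift_eq_zero_of_mem_verbalIdeal hP f)

theorem relLift_relProj (hP : InClass F P V) (f : Fin n → P)
    (x : FreeNonUnitalNonAssocAlgebra F (Fin n)) :
    relLift hP f (relProj V n x) = FreeNonUnitalNonAssocAlgebra.lift F f x := rfl

theorem relLift_gen (hP : InClass F P V) (f : Fin n → P) (i : Fin n) :
    relLift hP f (gen V i) = f i := by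
  rw [gen, relLift_relProj, FreeNonUnitalNonAssocAlgebra.lift_of_apply]

theorem relFree_hom_ext {φ ψ : RelFree V n →ₙₐ[F] P} (h : ∀ i, φ (gen V i) = ψ (gen V i)) :
    φ = ψ := by
  have e : φ.comp (relProj V n) = ψ.comp (relProj V n) :=
    FreeNonUnitalNonAssocAlgebra.hom_ext F h
  ext x
  obtain ⟨x, rfl⟩ := relProj_surjective x
  exact congr_fun (congr_arg DFunLike.coe e) x

/-- The value of a word on the free generators. -/
noncomputable def word (V : Set (FreeNonUnitalNonAssocAlgebra F ℕ)) {n : ℕ} (w : FreeMagma (Fin n)) :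
    RelFree V n := FreeMagma.lift (gen V) w

theorem word_mul (x y : FreeMagma (Fin n)) : word V (x * y) = word V x * word V y := by
  simp [word]

theorem word_of (i : Fin n) : word V (FreeMagma.of i) = gen V i := rfl

theorem span_range_relFree_word : Submodule.span F (Set.range (word V (n := n))) = ⊤ := by
  have h := congr_arg (Submodule.map (relProj V n : FreeNonUnitalNonAssocAlgebra F (Fin n) →ₗ[F] RelFree V n))
    (span_range_word (F := F) (X := Fin n))
  have hr : LinearMap.range (relProj V n : FreeNonUnitalNonAssocAlgebra F (Fin n) →ₗ[F] RelFree V n) = ⊤ := by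
    rw [LinearMap.range_eq_top]
    exact relProj_surjective
  rw [Submodule.map_span, ← Set.range_comp, Submodule.map_top, hr] at h
  rw [← h]
  congr 2
  funext w
  exact (map_freeMagma_lift (relProj V n : FreeNonUnitalNonAssocAlgebra F (Fin n) →ₙ* RelFree V n) _ w).symm

theorem relFree_induction {p : RelFree V n → Prop} (gen : ∀ i, p (gen V i))
    (mul : ∀ a b, p a → p b → p (a * b)) (zero : p 0) (add : ∀ a b, p a → p b → p (a + b))
    (smul : ∀ (r : F) a, p a → p (r • a)) (a : RelFree V n) : p a := by
  obtain ⟨a, rfl⟩ := relProj_surjective a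
  induction a using free_induction with
  | of x => exact gen x
  | mul a b ha hb => rw [map_mul]; exact mul _ _ ha hb
  | zero => rw [map_zero]; exact zero
  | add a b ha hb => rw [map_add]; exact add _ _ ha hb
  | smul r a ha => rw [map_smul]; exact smul _ _ ha

theorem finite_words (X : Type*) [Finite X] (k : ℕ) :
    {w : FreeMagma X | w.length ≤ k}.Finite := by
  induction k with
  | zero =>
    refine Set.Finite.subset Set.finite_empty fun w hw => ?_
    have h1 : w.length ≤ 0 := hw
    have := w.length_pos
    omega
  | succ k ih =>
    refine ((Set.finite_range (FreeMagma.of (α := X))).union (Set.Finite.image2 (· * ·) ih ih)).subset ?_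
    intro w hw
    rw [Set.mem_ofPred_eq] at hw
    induction w with
    | ih1 x => exact Or.inl ⟨x, rfl⟩
    | ih2 x y _ _ =>
      have hw : x.length + y.length ≤ k + 1 := hw
      have := x.length_pos
      have := y.length_pos
      exact Or.inr ⟨x, by rw [Set.mem_ofPred_eq]; omega, y, by rw [Set.mem_ofPred_eq]; omega, rfl⟩

variable {c : ℕ}

theorem power_relFree_eq_bot (hnil : IsStepNilpotentClass V c) (n : ℕ) :
    power F (RelFree V n) (c + 1) = ⊥ :=
  hnil.1 ⟨RelFree V n⟩ inClass_relFree

theorem word_eq_zero (hnil : IsStepNilpotentClass V c) (w : FreeMagma (Fin n))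
    (hw : c < w.length) : word V w = 0 := by
  have h := power_antitone (F := F) (by omega) hw (lift_mem_power (F := F) (gen V) w)
  rw [power_relFree_eq_bot hnil] at h
  exact h

theorem finiteDimensional_relFree (hnil : IsStepNilpotentClass V c) (n : ℕ) :
    FiniteDimensional F (RelFree V n) := by
  refine ⟨⟨(((finite_words (Fin n) c).image (word V)).toFinset), ?_⟩⟩
  rw [eq_top_iff, ← span_range_relFree_word, Submodule.span_le]
  rintro _ ⟨w, rfl⟩
  by_cases hw : w.length ≤ c
  · refine Submodule.subset_span ?_
    rw [Set.Finite.coe_toFinset]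
    exact ⟨w, hw, rfl⟩
  · rw [word_eq_zero hnil w (by omega)]
    exact zero_mem _

/-- A class of nilpotency step `c` has an algebra with a nonzero multilinear product of
length `c`. -/
theorem exists_multilinear_ne_zero (hnil : IsStepNilpotentClass V c) :
    ∃ P : Alg F, InClass F P.carrier V ∧ ∃ (w : FreeMagma ℕ) (f : ℕ → P.carrier),
      FreeMagma.lift f w ≠ 0 ∧ w.length = c ∧ ∀ i, occ i w = if i < c then 1 else 0 := by
  obtain ⟨P, hP, hne⟩ := hnil.2
  refine ⟨P, hP, ?_⟩
  obtain ⟨u, hu, hu0⟩ : ∃ u : FreeMagma P.carrier, u.length = c ∧ FreeMagma.lift id u ≠ 0 := by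
    by_contra! hcon
    refine hne ((Submodule.span_eq_bot).2 ?_)
    rintro _ ⟨u, hu, rfl⟩
    exact hcon u hu
  obtain ⟨w, f, h1, h2, h3⟩ := exists_multilinear_word u 0
  exact ⟨w, f, by rwa [h1], by rw [h2, hu], fun i => by simpa [hu] using h3 i⟩

theorem mem_power_iff (hcen : IsCentralClass V c) (hn : 2 ≤ n) {x : RelFree V n} :
    x ∈ power F (RelFree V n) c ↔ ∀ a, a * x = 0 ∧ x * a = 0 := by
  rw [← SetLike.mem_coe, ← hcen n hn]
  rfl

end RelFree

/-! ### Words sorted by their support -/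

section Supports

variable {F : Type u} [Field F] {V : Set (FreeNonUnitalNonAssocAlgebra F ℕ)} {n c : ℕ}

/-- The set of letters of a word. -/
def supp : FreeMagma (Fin n) → Finset (Fin n)
  | FreeMagma.of i => {i}
  | x * y => supp x ∪ supp y

theorem supp_of (i : Fin n) : supp (FreeMagma.of i) = {i} := rfl

theorem supp_mul (x y : FreeMagma (Fin n)) : supp (x * y) = supp x ∪ supp y := rfl

theorem card_supp_le (w : FreeMagma (Fin n)) : (supp w).card ≤ w.length := by
  induction w with
  | ih1 x => simp [supp_of]
  | ih2 x y hx hy =>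
    rw [supp_mul]
    exact (Finset.card_union_le _ _).trans (Nat.add_le_add hx hy)

/-- The endomorphism killing all generators outside `S`. -/
noncomputable def restr (V : Set (FreeNonUnitalNonAssocAlgebra F ℕ)) (S : Finset (Fin n)) :
    RelFree V n →ₙₐ[F] RelFree V n :=
  relLift inClass_relFree fun i => if i ∈ S then gen V i else 0

theorem restr_word (S : Finset (Fin n)) (w : FreeMagma (Fin n)) :
    restr V S (word V w) = if supp w ⊆ S then word V w else 0 := by
  induction w with
  | ih1 i => rw [word_of, restr, relLift_gen, supp_of]; simp
  | ih2 x y hx hy =>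
    rw [word_mul, map_mul, hx, hy, supp_mul]
    simp only [Finset.union_subset_iff]
    by_cases h1 : supp x ⊆ S <;> by_cases h2 : supp y ⊆ S <;> simp [h1, h2]

/-- The identity minus the substitution x_i ↦ 0 keeps exactly the words containing x_i. Thus
components by support are well defined although the identities need not be homogeneous. -/
theorem exists_proj_superset (T : Finset (Fin n)) : ∃ H : RelFree V n →ₗ[F] RelFree V n,
    ∀ w, H (word V w) = if T ⊆ supp w then word V w else 0 := by
  induction T using Finset.induction_on with
  | empty => exact ⟨LinearMap.id, by simp⟩
  | insert i T _ ih =>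
    obtain ⟨H, hH⟩ := ih
    refine ⟨H - (restr V {i}ᶜ : RelFree V n →ₗ[F] RelFree V n) ∘ₗ H, fun w => ?_⟩
    have e : (restr V {i}ᶜ : RelFree V n →ₗ[F] RelFree V n) (word V w) =
        if i ∉ supp w then word V w else 0 := by
      refine (restr_word _ w).trans (if_congr ?_ rfl rfl)
      rw [Finset.subset_compl_iff_disjoint_right, Finset.disjoint_singleton_right]
    rw [LinearMap.sub_apply, LinearMap.comp_apply, hH]
    simp only [Finset.insert_subset_iff]
    by_cases h1 : T ⊆ supp w
    · simp only [h1, if_true, and_true, e]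
      by_cases h2 : i ∈ supp w <;> simp [h2]
    · simp [h1]

theorem exists_proj_support (T : Finset (Fin n)) : ∃ E : RelFree V n →ₗ[F] RelFree V n,
    ∀ w, E (word V w) = if supp w = T then word V w else 0 := by
  obtain ⟨H, hH⟩ := exists_proj_superset (V := V) T
  refine ⟨H ∘ₗ (restr V T : RelFree V n →ₗ[F] RelFree V n), fun w => ?_⟩
  have e : (restr V T : RelFree V n →ₗ[F] RelFree V n) (word V w) =
      if supp w ⊆ T then word V w else 0 := restr_word _ w
  rw [LinearMap.comp_apply, e]
  by_cases h1 : supp w ⊆ T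
  · rw [if_pos h1, hH]
    exact if_congr ⟨fun h => h1.antisymm h, fun h => h.ge⟩ rfl rfl
  · rw [if_neg h1, map_zero, if_neg fun h => h1 h.le]

/-- The number whose binary digits mark the elements of a finite set. -/
def key (S : Finset (Fin n)) : ℕ := ∑ i ∈ S, 2 ^ (i : ℕ)

theorem key_injective : Function.Injective (key (n := n)) := by
  intro S T h
  have e : ∀ S : Finset (Fin n), key S = ∑ i ∈ S.map Fin.valEmbedding, 2 ^ i := by
    intro S; simp [key]
  rw [e, e] at h
  exact Finset.map_injective _ (Finset.geomSum_injective le_rfl h)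

theorem key_mono {S T : Finset (Fin n)} (h : S ⊆ T) : key S ≤ key T :=
  Finset.sum_le_sum_of_subset h

theorem key_insert {S : Finset (Fin n)} {j : Fin n} (hj : j ∉ S) :
    key (insert j S) = key S + 2 ^ (j : ℕ) := by
  rw [key, Finset.sum_insert hj, add_comm, key]

/-- The reason for binary weights: multiplication by x_j shifts the order on supports by at most
2^j, and by exactly 2^j when x_j is new. -/
theorem key_insert_le (S : Finset (Fin n)) (j : Fin n) :
    key (insert j S) ≤ key S + 2 ^ (j : ℕ) := by
  by_cases h : j ∈ S
  · rw [Finset.insert_eq_of_mem h]; exact Nat.le_add_right _ _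
  · rw [key_insert h]

/-- The span of the words whose support precedes `N`. -/
noncomputable def filt (V : Set (FreeNonUnitalNonAssocAlgebra F ℕ)) (n N : ℕ) : Submodule F (RelFree V n) :=
  Submodule.span F (word V '' {w | key (supp w) < N})

theorem word_mem_filt {w : FreeMagma (Fin n)} {N : ℕ} (h : key (supp w) < N) :
    word V w ∈ filt V n N := Submodule.subset_span ⟨w, h, rfl⟩

theorem filt_zero : filt V n 0 = ⊥ := by simp [filt]

theorem filt_mono : Monotone (filt V n) := fun _ _ h =>
  Submodule.span_mono (Set.image_mono fun _ hw => lt_of_lt_of_le hw h)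

theorem filt_eq_top : filt V n (key (Finset.univ : Finset (Fin n)) + 1) = ⊤ := by
  rw [eq_top_iff, ← span_range_relFree_word, Submodule.span_le]
  rintro _ ⟨w, rfl⟩
  exact word_mem_filt (Nat.lt_succ_of_le (key_mono (Finset.subset_univ _)))

theorem filt_succ_eq {N : ℕ} (h : ∀ w : FreeMagma (Fin n), key (supp w) = N → word V w = 0) :
    filt V n (N + 1) = filt V n N := by
  refine le_antisymm ?_ (filt_mono (Nat.le_succ _))
  rw [filt, Submodule.span_le]
  rintro _ ⟨w, hw, rfl⟩
  rcases Nat.lt_succ_iff_lt_or_eq.1 hw with h1 | h1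
  · exact word_mem_filt h1
  · rw [h w h1]; exact zero_mem _

theorem mul_gen_mem_filt {N : ℕ} {x : RelFree V n} (hx : x ∈ filt V n N) (j : Fin n) :
    x * gen V j ∈ filt V n (N + 2 ^ (j : ℕ)) ∧ gen V j * x ∈ filt V n (N + 2 ^ (j : ℕ)) := by
  induction hx using Submodule.span_induction with
  | mem x hx =>
    obtain ⟨w, hw, rfl⟩ := hx
    have hw : key (supp w) < N := hw
    have h := key_insert_le (supp w) j
    rw [← word_of, ← word_mul, ← word_mul]
    constructor
    · refine word_mem_filt ?_
      rw [supp_mul, supp_of, Finset.union_comm, ← Finset.insert_eq]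
      omega
    · refine word_mem_filt ?_
      rw [supp_mul, supp_of, ← Finset.insert_eq]
      omega
  | zero => simp
  | add y z _ _ h1 h2 =>
    rw [add_mul, mul_add]
    exact ⟨add_mem h1.1 h2.1, add_mem h1.2 h2.2⟩
  | smul a y _ h =>
    rw [smul_mul_assoc, mul_smul_comm]
    exact ⟨Submodule.smul_mem _ _ h.1, Submodule.smul_mem _ _ h.2⟩

variable (V n) in
/-- The span of the words with support `S`. -/
noncomputable def suppSpan (S : Finset (Fin n)) : Submodule F (RelFree V n) :=
  Submodule.span F (word V '' {w | supp w = S})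

theorem filt_succ_le (S : Finset (Fin n)) :
    filt V n (key S + 1) ≤ filt V n (key S) ⊔ suppSpan V n S := by
  rw [filt, Submodule.span_le]
  rintro _ ⟨w, hw, rfl⟩
  rcases Nat.lt_succ_iff_lt_or_eq.1 hw with h1 | h1
  · exact Submodule.mem_sup_left (word_mem_filt h1)
  · exact Submodule.mem_sup_right (Submodule.subset_span ⟨w, key_injective h1, rfl⟩)

theorem mul_gen_mem_suppSpan {S : Finset (Fin n)} {x : RelFree V n} (hx : x ∈ suppSpan V n S)
    (j : Fin n) :
    x * gen V j ∈ suppSpan V n (insert j S) ∧ gen V j * x ∈ suppSpan V n (insert j S) := by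
  induction hx using Submodule.span_induction with
  | mem x hx =>
    obtain ⟨w, hw, rfl⟩ := hx
    have hw : supp w = S := hw
    rw [← word_of, ← word_mul, ← word_mul]
    constructor
    · refine Submodule.subset_span ⟨_, ?_, rfl⟩
      rw [Set.mem_ofPred_eq, supp_mul, supp_of, Finset.union_comm, ← Finset.insert_eq, hw]
    · refine Submodule.subset_span ⟨_, ?_, rfl⟩
      rw [Set.mem_ofPred_eq, supp_mul, supp_of, ← Finset.insert_eq, hw]
  | zero => simp
  | add y z _ _ h1 h2 =>
    rw [add_mul, mul_add]
    exact ⟨add_mem h1.1 h2.1, add_mem h1.2 h2.2⟩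
  | smul a y _ h =>
    rw [smul_mul_assoc, mul_smul_comm]
    exact ⟨Submodule.smul_mem _ _ h.1, Submodule.smul_mem _ _ h.2⟩

theorem disjoint_suppSpan_filt (S : Finset (Fin n)) :
    Disjoint (suppSpan V n S) (filt V n (key S)) := by
  obtain ⟨E, hE⟩ := exists_proj_support (V := V) S
  rw [Submodule.disjoint_def]
  intro x h1 h2
  have e1 : E x = x := by
    clear h2
    induction h1 using Submodule.span_induction with
    | mem x hx =>
      obtain ⟨w, hw, rfl⟩ := hx
      have hw : supp w = S := hw
      rw [hE, if_pos hw]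
    | zero => simp
    | add y z _ _ h1 h2 => rw [map_add, h1, h2]
    | smul a y _ h => rw [map_smul, h]
  have e2 : E x = 0 := by
    clear h1 e1
    induction h2 using Submodule.span_induction with
    | mem x hx =>
      obtain ⟨w, hw, rfl⟩ := hx
      rw [hE, if_neg]
      rintro rfl
      exact lt_irrefl (key (supp w)) hw
    | zero => simp
    | add y z _ _ h1 h2 => rw [map_add, h1, h2, add_zero]
    | smul a y _ h => rw [map_smul, h, smul_zero]
  rw [← e1, e2]

/-- Since x_j does not occur in `x`, substituting `a` for x_j fixes `x` and turns the two given
relations into the required ones. -/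
theorem mul_eq_zero_of_mul_gen {S : Finset (Fin n)} {x : RelFree V n} (hx : x ∈ suppSpan V n S)
    {j : Fin n} (hj : j ∉ S) (h1 : x * gen V j = 0) (h2 : gen V j * x = 0) (a : RelFree V n) :
    a * x = 0 ∧ x * a = 0 := by
  set φ := relLift (inClass_relFree (V := V) (n := n)) fun i => if i = j then a else gen V i with hφ
  have e1 : φ (gen V j) = a := by rw [hφ, relLift_gen, if_pos rfl]
  have e0 : ∀ w : FreeMagma (Fin n), j ∉ supp w → φ (word V w) = word V w := by
    intro w
    induction w with
    | ih1 i =>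
      intro h
      rw [word_of, hφ, relLift_gen, if_neg]
      rintro rfl
      simp [supp_of] at h
    | ih2 x y hx hy =>
      intro h
      rw [supp_mul, Finset.notMem_union] at h
      rw [word_mul, map_mul, hx h.1, hy h.2]
  have e2 : φ x = x := by
    clear h1 h2
    induction hx using Submodule.span_induction with
    | mem x hx =>
      obtain ⟨w, hw, rfl⟩ := hx
      have hw : supp w = S := hw
      exact e0 w (by rwa [hw])
    | zero => simp
    | add y z _ _ h1 h2 => rw [map_add, h1, h2]
    | smul a y _ h => rw [map_smul, h]
  constructor
  · rw [← e1, ← e2, ← map_mul, h2, map_zero]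
  · rw [← e1, ← e2, ← map_mul, h1, map_zero]

/-- Let t be the component of `x` with support `S`. Its products with x_j have support S ∪ {j} and
also lie strictly below that support in the filtration, so they vanish. Then t annihilates
everything, and centrality puts it into the c-th power. -/
theorem mem_filt_sup_of_mul_gen_mem (hcen : IsCentralClass V c) (hn : 2 ≤ n)
    {S : Finset (Fin n)} {j : Fin n} (hj : j ∉ S) {x : RelFree V n}
    (hx : x ∈ filt V n (key S + 1) ⊔ power F (RelFree V n) c)
    (h1 : x * gen V j ∈ filt V n (key S + 2 ^ (j : ℕ)))
    (h2 : gen V j * x ∈ filt V n (key S + 2 ^ (j : ℕ))) :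
    x ∈ filt V n (key S) ⊔ power F (RelFree V n) c := by
  obtain ⟨y, hy, z, hz, rfl⟩ := Submodule.mem_sup.1 hx
  obtain ⟨v, hv, t, ht, rfl⟩ := Submodule.mem_sup.1 (filt_succ_le S hy)
  have hz' := (mem_power_iff hcen hn).1 hz (gen V j)
  have hv' := mul_gen_mem_filt hv j
  have ht' := mul_gen_mem_suppSpan ht j
  rw [add_mul, add_mul, hz'.2, add_zero] at h1
  rw [mul_add, mul_add, hz'.1, add_zero] at h2
  have hd := Submodule.disjoint_def.1 (disjoint_suppSpan_filt (V := V) (insert j S))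
  rw [key_insert hj] at hd
  have h3 := hd _ ht'.1 ((Submodule.add_mem_iff_right _ hv'.1).1 h1)
  have h4 := hd _ ht'.2 ((Submodule.add_mem_iff_right _ hv'.2).1 h2)
  refine add_mem (add_mem (Submodule.mem_sup_left hv) (Submodule.mem_sup_right ?_))
    (Submodule.mem_sup_right hz)
  exact (mem_power_iff hcen hn).2 (mul_eq_zero_of_mul_gen ht hj h3 h4)

end Supports

/-! ### Ideals meet the annihilator in large dimension -/

section IdealBound

variable {F : Type u} [Field F] {V : Set (FreeNonUnitalNonAssocAlgebra F ℕ)} {n c : ℕ}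

/-- A subspace closed under multiplication by arbitrary elements from both sides. -/
def IsIdeal {A : Type*} [NonUnitalNonAssocRing A] [Module F A] (I : Submodule F A) : Prop :=
  ∀ a : A, ∀ x ∈ I, a * x ∈ I ∧ x * a ∈ I

theorem finrank_le_of_map_le {W : Type*} [AddCommGroup W] [Module F W] [FiniteDimensional F W]
    (f : W →ₗ[F] W) {X Y Z : Submodule F W} (hYZ : Y ≤ Z) (h : ∀ x ∈ X, f x ∈ Z) :
    Module.finrank F X + Module.finrank F Y ≤
      Module.finrank F (X ⊓ Y.comap f : Submodule F W) + Module.finrank F Z := by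
  have e1 := finrank_map_add_finrank_inf_ker (Y.mkQ ∘ₗ f) X
  have e2 := finrank_map_add_finrank_inf_ker Y.mkQ Z
  rw [Submodule.ker_mkQ, inf_eq_right.2 hYZ] at e2
  rw [LinearMap.ker_comp, Submodule.ker_mkQ] at e1
  have e3 : Module.finrank F (X.map (Y.mkQ ∘ₗ f)) ≤ Module.finrank F (Z.map Y.mkQ) := by
    refine Submodule.finrank_mono ?_
    rw [Submodule.map_comp]
    refine Submodule.map_mono ?_
    rintro _ ⟨x, hx, rfl⟩
    exact h x hx
  omega

/-- Modulo the annihilator, x ↦ (x x_j, x_j x) embeds the layer of `I` at `S` into two copies of its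
layer at S ∪ {j}. -/
theorem finrank_filt_step [FiniteDimensional F (RelFree V n)] (hcen : IsCentralClass V c)
    (hn : 2 ≤ n) {I : Submodule F (RelFree V n)} (hI : IsIdeal I) {S : Finset (Fin n)}
    {j : Fin n} (hj : j ∉ S) :
    Module.finrank F (I ⊓ (filt V n (key S + 1) ⊔ power F (RelFree V n) c) : Submodule F _) -
      Module.finrank F (I ⊓ (filt V n (key S) ⊔ power F (RelFree V n) c) : Submodule F _) ≤
    2 * (Module.finrank F (I ⊓ filt V n (key (insert j S) + 1) : Submodule F _) -
      Module.finrank F (I ⊓ filt V n (key (insert j S)) : Submodule F _)) := by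
  rw [key_insert hj]
  set X := I ⊓ (filt V n (key S + 1) ⊔ power F (RelFree V n) c) with hX
  set Z := I ⊓ filt V n (key S + 2 ^ (j : ℕ) + 1) with hZ
  set Y := I ⊓ filt V n (key S + 2 ^ (j : ℕ)) with hY
  have hYZ : Y ≤ Z := inf_le_inf_left _ (filt_mono (Nat.le_succ _))
  let R := LinearMap.mulRight F (gen V j)
  let Lm := LinearMap.mulLeft F (gen V j)
  have hmem : ∀ x ∈ X, x * gen V j ∈ Z ∧ gen V j * x ∈ Z := by
    rintro x ⟨h1, h2⟩
    obtain ⟨y, hy, z, hz, rfl⟩ := Submodule.mem_sup.1 h2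
    have hz' := (mem_power_iff hcen hn).1 hz (gen V j)
    have hy' := mul_gen_mem_filt hy j
    refine ⟨⟨(hI _ _ h1).2, ?_⟩, ⟨(hI _ _ h1).1, ?_⟩⟩
    · rw [add_mul, hz'.2, add_zero, add_right_comm]; exact hy'.1
    · rw [mul_add, hz'.1, add_zero, add_right_comm]; exact hy'.2
  have s1 := finrank_le_of_map_le R hYZ fun x hx => (hmem x hx).1
  have s2 := finrank_le_of_map_le Lm (X := X ⊓ Y.comap R) hYZ fun x hx => (hmem x hx.1).2
  have s3 : X ⊓ Y.comap R ⊓ Y.comap Lm ≤ I ⊓ (filt V n (key S) ⊔ power F (RelFree V n) c) := by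
    rintro x ⟨⟨hx, h1⟩, h2⟩
    exact ⟨hx.1, mem_filt_sup_of_mul_gen_mem hcen hn hj hx.2 h1.2 h2.2⟩
  have s4 := Submodule.finrank_mono s3
  have s5 := Submodule.finrank_mono hYZ
  omega

theorem sum_key_telescope (a : ℕ → ℕ) (ha : Monotone a)
    (h : ∀ N, (∀ S : Finset (Fin n), key S ≠ N) → a (N + 1) = a N) :
    ∑ S : Finset (Fin n), (a (key S + 1) - a (key S)) =
      a (key (Finset.univ : Finset (Fin n)) + 1) - a 0 := by
  rw [← Finset.sum_range_tsub ha,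
    ← Finset.sum_image (s := Finset.univ) (g := key (n := n)) (f := fun N => a (N + 1) - a N)
      key_injective.injOn]
  refine Finset.sum_subset ?_ ?_
  · intro N hN
    obtain ⟨S, -, rfl⟩ := Finset.mem_image.1 hN
    exact Finset.mem_range.2 (Nat.lt_succ_of_le (key_mono (Finset.subset_univ _)))
  · intro N _ hN
    rw [h N, Nat.sub_self]
    rintro S rfl
    exact hN (Finset.mem_image_of_mem _ (Finset.mem_univ _))

theorem sum_insert_eq (b : Finset (Fin n) → ℕ) :
    ∑ S : Finset (Fin n), ∑ j ∈ Sᶜ, b (insert j S) = ∑ T : Finset (Fin n), T.card * b T := by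
  have e : ∀ T : Finset (Fin n), T.card * b T = ∑ _j ∈ T, b T := by simp
  simp only [e]
  rw [Finset.sum_sigma', Finset.sum_sigma']
  refine Finset.sum_bij' (fun x _ => ⟨insert x.2 x.1, x.2⟩) (fun x _ => ⟨x.1.erase x.2, x.2⟩)
    ?_ ?_ ?_ ?_ ?_
  · simp
  · simp
  · rintro ⟨S, j⟩ h
    simp only [Finset.mem_sigma, Finset.mem_compl] at h
    simp [Finset.erase_insert h.2]
  · rintro ⟨S, j⟩ h
    simp only [Finset.mem_sigma] at h
    simp [Finset.insert_erase h.2]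
  · simp

/-- An ideal not consisting of annihilating elements meets the annihilator in a subspace of much
larger dimension. -/
theorem finrank_ideal_bound [FiniteDimensional F (RelFree V n)] (hnil : IsStepNilpotentClass V c)
    (hcen : IsCentralClass V c) (hn : 2 ≤ n) {I : Submodule F (RelFree V n)} (hI : IsIdeal I) :
    (n - c) * (Module.finrank F I -
      Module.finrank F (I ⊓ power F (RelFree V n) c : Submodule F _)) ≤
    2 * (c * Module.finrank F I) := by
  -- The increments of `a` over all supports add up to dim I/(I ∩ A^c), those of `b` to dim I.
  set a : ℕ → ℕ := fun N =>
    Module.finrank F (I ⊓ (filt V n N ⊔ power F (RelFree V n) c) : Submodule F _) with ha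
  set b : ℕ → ℕ := fun N => Module.finrank F (I ⊓ filt V n N : Submodule F _) with hb
  have hzero : ∀ N, (∀ S : Finset (Fin n), key S ≠ N) → filt V n (N + 1) = filt V n N :=
    fun N h => filt_succ_eq fun w hw => absurd hw (h _)
  have hcard : ∀ S : Finset (Fin n), c < S.card → filt V n (key S + 1) = filt V n (key S) :=
    fun S h => filt_succ_eq fun w hw => word_eq_zero hnil w
      (by rw [← key_injective hw] at h; exact h.trans_le (card_supp_le w))
  have ca : ∀ N M, filt V n N = filt V n M → a N = a M := fun N M h => by
    simp only [ha]; rw [h]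
  have cb : ∀ N M, filt V n N = filt V n M → b N = b M := fun N M h => by
    simp only [hb]; rw [h]
  have ta := sum_key_telescope (n := n) a
    (fun _ _ h => Submodule.finrank_mono (inf_le_inf_left _ (sup_le_sup_right (filt_mono h) _)))
    (fun N h => ca _ _ (hzero N h))
  have tb := sum_key_telescope (n := n) b
    (fun _ _ h => Submodule.finrank_mono (inf_le_inf_left _ (filt_mono h)))
    (fun N h => cb _ _ (hzero N h))
  have ea1 : a (key (Finset.univ : Finset (Fin n)) + 1) = Module.finrank F I := by
    simp only [ha]; rw [filt_eq_top, top_sup_eq, inf_top_eq]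
  have ea0 : a 0 = Module.finrank F (I ⊓ power F (RelFree V n) c : Submodule F _) := by
    simp only [ha]; rw [filt_zero, bot_sup_eq]
  have eb1 : b (key (Finset.univ : Finset (Fin n)) + 1) = Module.finrank F I := by
    simp only [hb]; rw [filt_eq_top, inf_top_eq]
  have eb0 : b 0 = 0 := by
    simp only [hb]; rw [filt_zero, inf_bot_eq, finrank_bot]
  rw [ea1, ea0] at ta
  rw [eb1, eb0, Nat.sub_zero] at tb
  rw [← ta, ← tb, Finset.mul_sum, Finset.mul_sum, Finset.mul_sum]
  -- Nonzero words have at most c letters, so a relevant `S` has at least n - c letters outside it,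
  -- whereas a relevant T = S ∪ {j} arises from at most c pairs.
  calc ∑ S : Finset (Fin n), (n - c) * (a (key S + 1) - a (key S))
      ≤ ∑ S : Finset (Fin n), ∑ j ∈ Sᶜ, (a (key S + 1) - a (key S)) := by
        refine Finset.sum_le_sum fun S _ => ?_
        by_cases hS : c < S.card
        · simp [ca _ _ (hcard S hS)]
        · rw [Finset.sum_const, smul_eq_mul, Finset.card_compl, Fintype.card_fin]
          exact Nat.mul_le_mul_right _ (by omega)
    _ ≤ ∑ S : Finset (Fin n), ∑ j ∈ Sᶜ,
          2 * (b (key (insert j S) + 1) - b (key (insert j S))) :=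
        Finset.sum_le_sum fun S _ => Finset.sum_le_sum fun j hj =>
          finrank_filt_step hcen hn hI (Finset.mem_compl.1 hj)
    _ = ∑ T : Finset (Fin n), T.card * (2 * (b (key T + 1) - b (key T))) :=
        sum_insert_eq fun T => 2 * (b (key T + 1) - b (key T))
    _ ≤ _ := by
        refine Finset.sum_le_sum fun T _ => ?_
        by_cases hT : c < T.card
        · simp [cb _ _ (hcard T hT)]
        · rw [mul_left_comm]
          exact Nat.mul_le_mul_left _ (Nat.mul_le_mul_right _ (by omega))

end IdealBound

/-! ### Rank of a nonscalar derivation on c-th powers -/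

section Rank

variable {F : Type u} [Field F] {V : Set (FreeNonUnitalNonAssocAlgebra F ℕ)} {n c : ℕ}

theorem exists_basis_pair {W : Type*} [AddCommGroup W] [Module F W] [FiniteDimensional F W]
    {m : ℕ} (hm : Module.finrank F W = m + 2) {v u : W} (h : LinearIndependent F ![v, u]) :
    ∃ b : Module.Basis (Fin (m + 2)) F W, b 0 = v ∧ b 1 = u := by
  have hne : v ≠ u := fun e => by
    have := h.injective (a₁ := 0) (a₂ := 1) (by simpa using e)
    simp at this
  have hs : LinearIndepOn F id ({v, u} : Set W) := by
    have := h.linearIndepOn_id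
    simpa [Matrix.range_cons, Set.pair_comm] using this
  let b0 := Module.Basis.extend hs
  have : Fintype (hs.extend (Set.subset_univ _)) := FiniteDimensional.fintypeBasisIndex b0
  have hcard : Fintype.card (hs.extend (Set.subset_univ _)) = Fintype.card (Fin (m + 2)) := by
    rw [← Module.finrank_eq_card_basis b0, hm, Fintype.card_fin]
  let e := Fintype.equivOfCardEq hcard
  let b1 := b0.reindex e
  obtain ⟨k0, hk0⟩ : ∃ k, b1 k = v :=
    ⟨e ⟨v, Module.Basis.subset_extend hs (by simp)⟩, by simp [b1, b0]⟩
  obtain ⟨k1, hk1⟩ : ∃ k, b1 k = u :=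
    ⟨e ⟨u, Module.Basis.subset_extend hs (by simp)⟩, by simp [b1, b0]⟩
  have hk : k0 ≠ k1 := fun hk => hne (by rw [← hk0, ← hk1, hk])
  let b2 := b1.reindex (Equiv.swap k0 0)
  have h20 : b2 0 = v := by simp [b2, hk0]
  have h21 : b2 (Equiv.swap k0 0 k1) = u := by simp [b2, hk1]
  have h22 : Equiv.swap k0 0 k1 ≠ 0 := by
    intro h
    have h' := congr_arg (Equiv.swap k0 0) h
    rw [Equiv.swap_apply_self, Equiv.swap_apply_right] at h'
    exact hk h'.symm
  refine ⟨b2.reindex (Equiv.swap (Equiv.swap k0 0 k1) 1), ?_, ?_⟩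
  · rw [Module.Basis.reindex_apply, Equiv.symm_swap,
      Equiv.swap_apply_of_ne_of_ne h22.symm (by simp), h20]
  · rw [Module.Basis.reindex_apply, Equiv.symm_swap, Equiv.swap_apply_right, h21]

theorem derivation_mem_power {A : Type*} [NonUnitalNonAssocRing A] [Module F A]
    [IsScalarTower F A A] [SMulCommClass F A A] (D : A →ₗ[F] A) (hD : IsDerivation F A D)
    {i : ℕ} {x : A} (hx : x ∈ power F A i) : D x ∈ power F A i := by
  induction hx using Submodule.span_induction with
  | mem x hx =>
    obtain ⟨w, rfl, rfl⟩ := hx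
    induction w with
    | ih1 x =>
      rw [show (FreeMagma.of x).length = 1 from rfl, power_one]; trivial
    | ih2 x y hx hy =>
      rw [map_mul, hD]
      exact add_mem (mul_mem_power hx (lift_mem_power (F := F) (id : A → A) y))
        (mul_mem_power (lift_mem_power (F := F) (id : A → A) x) hy)
  | zero => simp
  | add y z _ _ h1 h2 => rw [map_add]; exact add_mem h1 h2
  | smul a y _ h => rw [map_smul]; exact Submodule.smul_mem _ _ h

/-- The linear forms in the generators of the free algebra. -/
noncomputable def linForm (F : Type u) [Field F] (n : ℕ) :
    (Fin n → F) →ₗ[F] FreeNonUnitalNonAssocAlgebra F (Fin n) :=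
  Fintype.linearCombination F (FreeNonUnitalNonAssocAlgebra.of F)

theorem linForm_single (i : Fin n) :
    linForm F n (Pi.single i 1) = FreeNonUnitalNonAssocAlgebra.of F i := by
  simp [linForm, Fintype.linearCombination_apply_single]

theorem exists_derivation_linForm (δ : (Fin n → F) →ₗ[F] (Fin n → F)) :
    ∃ D : FreeNonUnitalNonAssocAlgebra F (Fin n) →ₗ[F] FreeNonUnitalNonAssocAlgebra F (Fin n),
      IsDerivation F _ D ∧ ∀ v, D (linForm F n v) = linForm F n (δ v) := by
  obtain ⟨D, hD, h⟩ := exists_derivation (F := F) (fun i : Fin n => linForm F n (δ (Pi.single i 1)))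
  refine ⟨D, hD, fun v => ?_⟩
  have e : D ∘ₗ linForm F n = linForm F n ∘ₗ δ := by
    refine (Pi.basisFun F (Fin n)).ext fun i => ?_
    simp [linForm_single, h]
  exact LinearMap.congr_fun e v

variable (V n c) in
/-- The projection of the free algebra to the relatively free one restricted to `c`-th powers. -/
noncomputable def projPower :
    power F (FreeNonUnitalNonAssocAlgebra F (Fin n)) c →ₗ[F] power F (RelFree V n) c :=
  LinearMap.restrict
    (relProj V n : FreeNonUnitalNonAssocAlgebra F (Fin n) →ₗ[F] RelFree V n)
    fun _ hx => map_mem_power (relProj V n) hx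

theorem projPower_surjective : Function.Surjective (projPower V n c) := by
  rintro ⟨y, hy⟩
  obtain ⟨x, hx, rfl⟩ := exists_mem_power (relProj V n) relProj_surjective hy
  exact ⟨⟨x, hx⟩, rfl⟩

/-- A derivation of the free algebra restricted to `c`-th powers. -/
noncomputable def derPower
    (D : FreeNonUnitalNonAssocAlgebra F (Fin n) →ₗ[F] FreeNonUnitalNonAssocAlgebra F (Fin n))
    (hD : IsDerivation F _ D) (c : ℕ) :
    power F (FreeNonUnitalNonAssocAlgebra F (Fin n)) c →ₗ[F]
      power F (FreeNonUnitalNonAssocAlgebra F (Fin n)) c :=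
  D.restrict fun _ hx => derivation_mem_power D hD hx

/-- Some v is independent of δ v. Values of a multilinear word with v in one slot and n - c
different basis vectors in another are separated, after applying the derivation, by homomorphisms
that kill v but not δ v. -/
theorem le_finrank_range_derPower [FiniteDimensional F (RelFree V n)]
    (hnil : IsStepNilpotentClass V c) (hc : 2 ≤ c)
    {δ : (Fin n → F) →ₗ[F] (Fin n → F)} (hδ : ∀ l : F, δ ≠ l • LinearMap.id)
    {D : FreeNonUnitalNonAssocAlgebra F (Fin n) →ₗ[F] FreeNonUnitalNonAssocAlgebra F (Fin n)}
    (hD : IsDerivation F _ D) (hDδ : ∀ v, D (linForm F n v) = linForm F n (δ v)) (l : F) :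
    n - c ≤ Module.finrank F (LinearMap.range
      (projPower V n c ∘ₗ derPower D hD c - l • projPower V n c)) := by
  rcases lt_or_ge n c with hnc | hnc
  · omega
  obtain ⟨m, rfl⟩ : ∃ m, n = m + 2 := ⟨n - 2, by omega⟩
  obtain ⟨v, hv⟩ : ∃ v, LinearIndependent F ![v, δ v] := by
    by_contra! hcon
    obtain ⟨a, ha⟩ := LinearMap.exists_eq_smul_id_of_forall_notLinearIndependent hcon
    exact hδ a ha
  obtain ⟨b, hb0, hb1⟩ := exists_basis_pair (m := m) (by simp) hv
  obtain ⟨P, hP, w, f, hw0, hwc, hocc⟩ := exists_multilinear_ne_zero hnil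
  have ho0 : occ 0 w = 1 := by rw [hocc, if_pos (by omega)]
  have ho1 : occ 1 w = 1 := by rw [hocc, if_pos (by omega)]
  have hlt : ∀ t : Fin (m + 2 - c), c + t.1 < m + 2 := fun t => by omega
  -- Letter 0 receives b 0 = v and letter 1 the vector b (c + t) varying with `t`. The last default
  -- is never reached, because `w` has only letters below `c`.
  let a : Fin (m + 2 - c) → ℕ → Fin (m + 2) := fun t i =>
    if i = 0 then 0 else if i = 1 then ⟨c + t.1, hlt t⟩ else
      if h : i < c then ⟨i, by omega⟩ else 0
  -- Here b 0 is killed, b 1 = δ v takes the value of letter 0, and b (c + t) that of letter 1; a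
  -- different index in place of `t` gives 0 in slot 1.
  let g : Fin (m + 2 - c) → Fin (m + 2) → P.carrier := fun t k =>
    if k.1 = 0 then 0 else if k.1 = 1 then f 0 else if k.1 < c then f k.1 else
      if k.1 = c + t.1 then f 1 else 0
  let G : Fin (m + 2 - c) → (Fin (m + 2) → F) →ₗ[F] P.carrier := fun t => b.constr F (g t)
  let φ : Fin (m + 2 - c) → (FreeNonUnitalNonAssocAlgebra F (Fin (m + 2)) →ₙₐ[F] P.carrier) :=
    fun t => FreeNonUnitalNonAssocAlgebra.lift F fun i => G t (Pi.single i 1)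
  have hφ : ∀ t v, φ t (linForm F (m + 2) v) = G t v := by
    intro t v
    have e : (φ t : FreeNonUnitalNonAssocAlgebra F (Fin (m + 2)) →ₗ[F] P.carrier) ∘ₗ
        linForm F (m + 2) = G t := by
      refine (Pi.basisFun F (Fin (m + 2))).ext fun i => ?_
      rw [LinearMap.comp_apply, Pi.basisFun_apply, linForm_single]
      exact FreeNonUnitalNonAssocAlgebra.lift_of_apply F _ i
    exact LinearMap.congr_fun e v
  have hφb : ∀ t k, φ t (linForm F (m + 2) (b k)) = g t k := fun t k => by
    rw [hφ]; exact b.constr_basis F (g t) k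
  let A : Fin (m + 2 - c) → ℕ → FreeNonUnitalNonAssocAlgebra F (Fin (m + 2)) := fun t i =>
    linForm F (m + 2) (b (a t i))
  -- Killing b 0 kills the undifferentiated words, so the term with `l` drops out and the bound is
  -- uniform in `l`.
  have hA0 : ∀ t t', φ t (A t' 0) = 0 := fun t t' => by simp [A, hφb, a, g]
  have hlift : ∀ t t', φ t (FreeMagma.lift (A t') w) = 0 := by
    intro t t'
    have h1 : φ t (FreeMagma.lift (A t') w) = FreeMagma.lift (fun i => φ t (A t' i)) w :=
      map_freeMagma_lift
        (φ t : FreeNonUnitalNonAssocAlgebra F (Fin (m + 2)) →ₙ* P.carrier) (A t') w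
    rw [h1]
    exact lift_eq_zero_of_occ (f := fun i => φ t (A t' i)) (hA0 t t') w (by omega)
  have hder : ∀ t t', φ t (D (FreeMagma.lift (A t') w)) = FreeMagma.lift (Function.update
      (fun i => φ t (A t' i)) 0 (f 0)) w := by
    intro t t'
    rw [hom_derivation_lift (φ t) D hD (hA0 t t') w ho0]
    congr 3
    simp only [A, a, if_true]
    rw [hDδ, hb0, ← hb1, hφb]
    simp [g]
  have hdiag : ∀ t, φ t (D (FreeMagma.lift (A t) w)) ≠ 0 := by
    intro t
    rw [hder]
    convert hw0 using 1
    refine lift_congr_of_occ w fun i hi => ?_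
    have hic : i < c := by
      by_contra hcon
      rw [hocc, if_neg hcon] at hi
      exact hi rfl
    rcases eq_or_ne i 0 with rfl | h0
    · simp
    rw [Function.update_of_ne h0]
    simp only [A, hφb]
    rcases eq_or_ne i 1 with rfl | h1
    · simp only [a, g, one_ne_zero, if_false, if_true]
      rw [if_neg (by omega), if_neg (by omega), if_neg (by omega)]
    · simp only [a, g, h0, h1, hic, if_false, if_true, dif_pos]
  have hoff : ∀ t t', t ≠ t' → φ t (D (FreeMagma.lift (A t') w)) = 0 := by
    intro t t' htt
    rw [hder]
    refine lift_eq_zero_of_occ (i := 1) ?_ w (by omega)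
    rw [Function.update_of_ne one_ne_zero]
    simp only [A, hφb]
    simp only [a, g, one_ne_zero, if_false, if_true]
    have : (t' : ℕ) ≠ t := fun h => htt (Fin.ext h.symm)
    rw [if_neg (by omega), if_neg (by omega), if_neg (by omega), if_neg (by omega)]
  have hAmem : ∀ t, FreeMagma.lift (A t) w ∈
      power F (FreeNonUnitalNonAssocAlgebra F (Fin (m + 2))) c := fun t => by
    have := lift_mem_power (F := F) (A t) w
    rwa [hwc] at this
  let z : Fin (m + 2 - c) → power F (RelFree V (m + 2)) c := fun t =>
    (projPower V (m + 2) c ∘ₗ derPower D hD c - l • projPower V (m + 2) c)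
      ⟨FreeMagma.lift (A t) w, hAmem t⟩
  let θ : Fin (m + 2 - c) → (power F (RelFree V (m + 2)) c →ₗ[F] P.carrier) := fun t =>
    (relLift hP (fun i => G t (Pi.single i 1)) : RelFree V (m + 2) →ₗ[F] P.carrier) ∘ₗ
      Submodule.subtype _
  have hθ : ∀ t t', θ t (z t') = φ t (D (FreeMagma.lift (A t') w)) := by
    intro t t'
    have e : θ t (z t') = φ t (D (FreeMagma.lift (A t') w)) -
        l • φ t (FreeMagma.lift (A t') w) := by
      simp only [z, LinearMap.sub_apply, map_sub, LinearMap.smul_apply, map_smul]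
      rfl
    rw [e, hlift, smul_zero, sub_zero]
  have hz : LinearIndependent F z := by
    rw [Fintype.linearIndependent_iff]
    intro r hr t
    have h := congr_arg (θ t) hr
    rw [map_sum, map_zero, Finset.sum_eq_single t] at h
    · rw [map_smul, hθ] at h
      exact (smul_eq_zero.1 h).resolve_right (hdiag t)
    · intro t' _ htt
      rw [map_smul, hθ, hoff t t' htt.symm, smul_zero]
    · simp
  have hz' : LinearIndependent F (fun t => (⟨z t, ⟨_, rfl⟩⟩ : LinearMap.range
      (projPower V (m + 2) c ∘ₗ derPower D hD c - l • projPower V (m + 2) c))) :=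
    LinearIndependent.of_comp (Submodule.subtype _) hz
  simpa using hz'.fintype_card_le_finrank

/-- For j ≠ i, the equation (∑ r_k x_k) x_j = 0 holds identically in the class. Substituting y for
x_i, z for x_j and 0 elsewhere gives r_i yz + r_j zz = 0; the case y = 0 removes the second term. -/
theorem mul_eq_zero_of_sum_gen_mem (hcen : IsCentralClass V c) (hn : 2 ≤ n) {r : Fin n → F}
    (hr : ∑ i, r i • gen V i ∈ power F (RelFree V n) c) {i : Fin n} (hi : r i ≠ 0)
    {P : Type*} [NonUnitalNonAssocRing P] [Module F P] [IsScalarTower F P P] [SMulCommClass F P P]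
    (hP : InClass F P V) (y z : P) : y * z = 0 := by
  obtain ⟨j, hj⟩ : ∃ j : Fin n, j ≠ i := by
    have : Nontrivial (Fin n) := Fin.nontrivial_iff_two_le.2 hn
    exact exists_ne i
  have h0 := ((mem_power_iff hcen hn).1 hr (gen V j)).2
  have key : ∀ y, r i • (y * z) + r j • (z * z) = 0 := by
    intro y
    set f : Fin n → P := fun k => if k = i then y else if k = j then z else 0 with hf
    have h1 := congr_arg (relLift hP f) h0
    rw [map_mul, map_sum, map_zero, relLift_gen] at h1
    simp only [map_smul, relLift_gen] at h1
    have h2 : ∑ k, r k • f k = r i • y + r j • z := by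
      rw [Fintype.sum_eq_add i j hj.symm]
      · simp [hf, hj]
      · rintro k ⟨h1, h2⟩
        simp [hf, h1, h2]
    rw [h2, add_mul] at h1
    simpa [hf, hj, smul_mul_assoc] using h1
  have h1 := key 0
  rw [zero_mul, smul_zero, zero_add] at h1
  have h2 := key y
  rw [h1, add_zero] at h2
  exact (smul_eq_zero.1 h2).resolve_left hi

/-- A dependence would be a nontrivial linear form in the annihilator, making all products in the
class zero, whereas c ≥ 2 and some c-th power is nonzero. -/
theorem linearIndependent_mkQ_gen (hnil : IsStepNilpotentClass V c) (hc : 2 ≤ c)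
    (hcen : IsCentralClass V c) (hn : 2 ≤ n) :
    LinearIndependent F fun i : Fin n => (power F (RelFree V n) c).mkQ (gen V i) := by
  rw [Fintype.linearIndependent_iff]
  intro r hr i
  by_contra hi
  have hmem : ∑ i, r i • gen V i ∈ power F (RelFree V n) c := by
    rw [← Submodule.Quotient.mk_eq_zero, ← Submodule.mkQ_apply, map_sum]
    simpa using hr
  obtain ⟨P, hP, w, f, hw0, hwc, -⟩ := exists_multilinear_ne_zero hnil
  apply hw0
  cases w with
  | of x => simp [FreeMagma.length] at hwc; omega
  | mul x y =>
    rw [FreeMagma.mul_eq, map_mul]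
    exact mul_eq_zero_of_sum_gen_mem hcen hn hmem hi hP _ _

theorem finrank_power_add_le (hnil : IsStepNilpotentClass V c) (hc : 2 ≤ c)
    (hcen : IsCentralClass V c) (hn : 2 ≤ n) [FiniteDimensional F (RelFree V n)] :
    Module.finrank F (power F (RelFree V n) c) + n ≤ Module.finrank F (RelFree V n) := by
  have h := (linearIndependent_mkQ_gen hnil hc hcen hn).fintype_card_le_finrank
  have h2 := Submodule.finrank_quotient_add_finrank (power F (RelFree V n) c)
  rw [Fintype.card_fin] at h
  omega

end Rank

/-! ### Isomorphism classes as ideals of the free algebra -/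

section Classes

variable {F : Type u} [Field F] {V : Set (FreeNonUnitalNonAssocAlgebra F ℕ)} {n c : ℕ}

theorem AlgIdeal.toSubmodule_injective {A : Type*} [NonUnitalNonAssocRing A] [Module F A] :
    Function.Injective (AlgIdeal.toSubmodule : AlgIdeal F A → Submodule F A) := by
  rintro ⟨I, _, _⟩ ⟨J, _, _⟩ h
  cases h
  rfl

theorem AlgIdeal.isIdeal {A : Type*} [NonUnitalNonAssocRing A] [Module F A] (I : AlgIdeal F A) :
    IsIdeal I.toSubmodule := fun a _ hx => ⟨I.mul_left_mem a hx, I.mul_right_mem a hx⟩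

/-- The quotient of a relatively free algebra as a bundled algebra. -/
noncomputable def quotAlg (I : AlgIdeal F (RelFree V n)) : Alg F := ⟨I.Quot⟩

/-- The isomorphism class of a quotient of a relatively free algebra. -/
noncomputable def quotClass (I : AlgIdeal F (RelFree V n)) : Quotient (algSetoid F) :=
  Quotient.mk (algSetoid F) (quotAlg I)

theorem quotClass_eq_iff {I J : AlgIdeal F (RelFree V n)} :
    quotClass I = quotClass J ↔ ∃ f : I.Quot →ₙₐ[F] J.Quot, Function.Bijective f :=
  Quotient.eq

theorem inClass_quot (I : AlgIdeal F (RelFree V n)) : InClass F I.Quot V :=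
  inClass_relFree.of_surjective I.projHom I.projHom_surjective

theorem isGeneratedBy_quot (I : AlgIdeal F (RelFree V n)) : IsGeneratedBy F I.Quot n := by
  refine ⟨fun i => I.projHom (gen V i), eq_top_iff.2 fun x _ => ?_⟩
  obtain ⟨x, rfl⟩ := I.projHom_surjective x
  induction x using relFree_induction with
  | gen i => exact NonUnitalAlgebra.subset_adjoin F ⟨i, rfl⟩
  | mul a b ha hb => rw [map_mul]; exact mul_mem (ha trivial) (hb trivial)
  | zero => rw [map_zero]; exact zero_mem _
  | add a b ha hb => rw [map_add]; exact add_mem (ha trivial) (hb trivial)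
  | smul r a ha => rw [map_smul]; exact SMulMemClass.smul_mem _ (ha trivial)

theorem quotClass_mem_isoClasses {p : Alg F → Prop} (I : AlgIdeal F (RelFree V n))
    (hp : p (quotAlg I)) : quotClass I ∈ isoClasses V p n :=
  ⟨quotAlg I, rfl, inClass_quot I, isGeneratedBy_quot I, hp⟩

theorem exists_quotClass_eq {p : Alg F → Prop} {x : Quotient (algSetoid F)}
    (hx : x ∈ isoClasses V p n) : ∃ I : AlgIdeal F (RelFree V n), quotClass I = x := by
  obtain ⟨P, rfl, hP, ⟨a, ha⟩, -⟩ := hx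
  let φ : RelFree V n →ₙₐ[F] P.carrier := relLift hP a
  have hφ : Function.Surjective φ := by
    intro y
    have hy : y ∈ NonUnitalAlgebra.adjoin F (Set.range a) := by rw [ha]; trivial
    have hle : NonUnitalAlgebra.adjoin F (Set.range a) ≤ NonUnitalAlgHom.range φ := by
      refine NonUnitalAlgebra.adjoin_le ?_
      rintro _ ⟨i, rfl⟩
      exact ⟨gen V i, relLift_gen hP a i⟩
    exact hle hy
  refine ⟨kerIdeal φ, Quotient.sound ⟨(kerIdeal φ).liftHom φ fun x hx => (mem_kerIdeal φ).1 hx, ?_, ?_⟩⟩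
  · intro x y h
    obtain ⟨x, rfl⟩ := (kerIdeal φ).projHom_surjective x
    obtain ⟨y, rfl⟩ := (kerIdeal φ).projHom_surjective y
    have h : φ x = φ y := h
    change (kerIdeal φ).projHom x = (kerIdeal φ).projHom y
    rw [← sub_eq_zero, ← map_sub, AlgIdeal.projHom_eq_zero, mem_kerIdeal, map_sub, h, sub_self]
  · intro y
    obtain ⟨x, rfl⟩ := hφ y
    exact ⟨(kerIdeal φ).projHom x, rfl⟩

theorem isoClasses_true_eq : isoClasses V (fun _ => True) n =
    Set.range (quotClass (V := V) (n := n)) := by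
  refine Set.Subset.antisymm (fun x hx => exists_quotClass_eq hx) ?_
  rintro _ ⟨I, rfl⟩
  exact quotClass_mem_isoClasses I trivial

theorem isoClasses_subset (p : Alg F → Prop) :
    isoClasses V p n ⊆ isoClasses V (fun _ => True) n := by
  rintro x ⟨P, h1, h2, h3, -⟩
  exact ⟨P, h1, h2, h3, trivial⟩

theorem isoClasses_diff_subset (p : Alg F → Prop) :
    isoClasses V (fun _ => True) n \ isoClasses V p n ⊆
      quotClass (V := V) (n := n) '' {I | ¬ p (quotAlg I)} := by
  rintro x ⟨h1, h2⟩
  obtain ⟨I, rfl⟩ := exists_quotClass_eq h1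
  exact ⟨I, fun h => h2 (quotClass_mem_isoClasses I h), rfl⟩

theorem finite_algIdeal [Finite F] (hnil : IsStepNilpotentClass V c) :
    Finite (AlgIdeal F (RelFree V n)) := by
  have := finiteDimensional_relFree hnil n
  have : Finite (Submodule F (RelFree V n)) := finite_submodule
  exact Finite.of_injective _ AlgIdeal.toSubmodule_injective

/-- Every element of a relatively free algebra is congruent to a linear form modulo the square. -/
theorem exists_sub_linForm_mem (x : RelFree V n) :
    ∃ v, x - relProj V n (linForm F n v) ∈ power F (RelFree V n) 2 := by
  induction x using relFree_induction with
  | gen i => exact ⟨Pi.single i 1, by rw [linForm_single]; simp [gen]⟩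
  | mul a b _ _ => exact ⟨0, by simpa using mul_mem_power_two a b⟩
  | zero => exact ⟨0, by simp⟩
  | add a b ha hb =>
    obtain ⟨v, hv⟩ := ha
    obtain ⟨w, hw⟩ := hb
    refine ⟨v + w, ?_⟩
    rw [map_add, map_add, add_sub_add_comm]
    exact add_mem hv hw
  | smul r a ha =>
    obtain ⟨v, hv⟩ := ha
    refine ⟨r • v, ?_⟩
    rw [map_smul, map_smul, ← smul_sub]
    exact Submodule.smul_mem _ _ hv

/-- The difference φ - ψ is a skew derivation with values in the square, so it sends c-th powers to
the (c+1)-st power, which is zero. -/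
theorem hom_eq_of_sub_mem_power_two {P : Type*} [NonUnitalNonAssocRing P] [Module F P]
    [IsScalarTower F P P] [SMulCommClass F P P] (hP : power F P (c + 1) = ⊥)
    (φ ψ : RelFree V n →ₙₐ[F] P) (h : ∀ i, φ (gen V i) - ψ (gen V i) ∈ power F P 2)
    {x : RelFree V n} (hx : x ∈ power F (RelFree V n) c) : φ x = ψ x := by
  let τ : RelFree V n →ₗ[F] P := (φ : RelFree V n →ₗ[F] P) - (ψ : RelFree V n →ₗ[F] P)
  have hτ : ∀ x, τ x = φ x - ψ x := fun _ => rfl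
  have hmul : ∀ x y, τ (x * y) = τ x * φ y + ψ x * τ y := by
    intro x y
    rw [hτ, hτ, hτ, map_mul, map_mul, sub_mul, mul_sub]
    abel
  have h2 : ∀ x, τ x ∈ power F P 2 := by
    intro x
    induction x using relFree_induction with
    | gen i => exact h i
    | mul a b _ _ => rw [hmul]; exact add_mem (mul_mem_power_two _ _) (mul_mem_power_two _ _)
    | zero => simp
    | add a b ha hb => rw [map_add]; exact add_mem ha hb
    | smul r a ha => rw [map_smul]; exact Submodule.smul_mem _ _ ha
  have h3 := skewDerivation_mem_power τ φ ψ hmul h2 hx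
  rw [hP, Submodule.mem_bot, hτ] at h3
  exact sub_eq_zero.1 h3

/-- The isomorphism lifts to an endomorphism of the free algebra; keeping only the linear parts of
the images of the generators changes nothing on c-th powers. Hence `J` and the matrix `g` determine
`I`. -/
theorem exists_matrix_of_quotClass_eq (hnil : IsStepNilpotentClass V c)
    {I J : AlgIdeal F (RelFree V n)} (hI : I.toSubmodule ≤ power F (RelFree V n) c)
    (h : quotClass I = quotClass J) : ∃ g : Fin n → Fin n → F, ∀ x, x ∈ I.toSubmodule ↔
      x ∈ power F (RelFree V n) c ∧
        relLift inClass_relFree (fun i => relProj V n (linForm F n (g i))) x ∈ J.toSubmodule := by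
  obtain ⟨f, hf⟩ := quotClass_eq_iff.1 h
  choose r hr using fun i => J.projHom_surjective (f (I.projHom (gen V i)))
  choose g hg using fun i => exists_sub_linForm_mem (r i)
  have e : J.projHom.comp (relLift inClass_relFree r) = f.comp I.projHom :=
    relFree_hom_ext fun i => by
      simp only [NonUnitalAlgHom.comp_apply, relLift_gen, hr]
  refine ⟨g, fun x => ?_⟩
  have key : x ∈ power F (RelFree V n) c → (x ∈ I.toSubmodule ↔
      relLift inClass_relFree (fun i => relProj V n (linForm F n (g i))) x ∈ J.toSubmodule) := by
    intro hx
    rw [← hom_eq_of_sub_mem_power_two (power_relFree_eq_bot hnil n)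
      (relLift inClass_relFree r) _ (fun i => by rw [relLift_gen, relLift_gen]; exact hg i) hx,
      ← J.projHom_eq_zero, ← I.projHom_eq_zero]
    have e' : J.projHom (relLift inClass_relFree r x) = f (I.projHom x) :=
      congr_fun (congr_arg DFunLike.coe e) x
    rw [e']
    exact ⟨fun h => by rw [h, map_zero], fun h => hf.1 (by rw [h, map_zero])⟩
  exact ⟨fun h => ⟨hI h, (key (hI h)).1 h⟩, fun h => (key h.1).2 h.2⟩

theorem ncard_quotClass_fiber_le [Finite F] (hnil : IsStepNilpotentClass V c)
    (J : AlgIdeal F (RelFree V n)) :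
    {I : AlgIdeal F (RelFree V n) | I.toSubmodule ≤ power F (RelFree V n) c ∧
      quotClass I = quotClass J}.ncard ≤ Nat.card F ^ (n * n) := by
  have hc : Nat.card (Fin n → Fin n → F) = Nat.card F ^ (n * n) := by
    rw [Nat.card_fun, Nat.card_fun, ← pow_mul, Nat.card_fin]
  rw [← hc, ← Nat.card_coe_set_eq]
  choose g hg using fun I : {I : AlgIdeal F (RelFree V n) |
    I.toSubmodule ≤ power F (RelFree V n) c ∧ quotClass I = quotClass J} =>
      exists_matrix_of_quotClass_eq hnil I.2.1 I.2.2
  refine Nat.card_le_card_of_injective g fun I I' h => ?_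
  ext1
  refine AlgIdeal.toSubmodule_injective (Submodule.ext fun x => ?_)
  rw [hg I, hg I', h]

/-- The ideal with a given underlying subspace of the annihilator. -/
noncomputable def centralIdeal (hcen : IsCentralClass V c) (hn : 2 ≤ n)
    (W : Submodule F (power F (RelFree V n) c)) : AlgIdeal F (RelFree V n) where
  toSubmodule := W.map (Submodule.subtype _)
  mul_left_mem := by
    rintro a _ ⟨x, _, rfl⟩
    have h : a * (x : RelFree V n) = 0 := ((mem_power_iff hcen hn).1 x.2 a).1
    change a * (x : RelFree V n) ∈ W.map (Submodule.subtype _)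
    rw [h]
    exact zero_mem _
  mul_right_mem := by
    rintro a _ ⟨x, _, rfl⟩
    have h : (x : RelFree V n) * a = 0 := ((mem_power_iff hcen hn).1 x.2 a).2
    change (x : RelFree V n) * a ∈ W.map (Submodule.subtype _)
    rw [h]
    exact zero_mem _

theorem card_submodule_power_le [Finite F] (hnil : IsStepNilpotentClass V c)
    (hcen : IsCentralClass V c) (hn : 2 ≤ n) :
    Nat.card (Submodule F (power F (RelFree V n) c)) ≤
      (isoClasses V (fun _ => True) n).ncard * Nat.card F ^ (n * n) := by
  have := finiteDimensional_relFree hnil n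
  have := finite_algIdeal (V := V) (n := n) hnil
  have : Finite (Submodule F (power F (RelFree V n) c)) := finite_submodule
  rw [isoClasses_true_eq]
  have hinj : Function.Injective (centralIdeal (V := V) hcen hn) := by
    intro W W' h
    exact Submodule.map_injective_of_injective (Submodule.subtype_injective _)
      (congr_arg AlgIdeal.toSubmodule h)
  have key := ncard_mul_le_card_mul (β := Set.range (quotClass (V := V) (n := n)))
    (Set.univ : Set (Submodule F (power F (RelFree V n) c)))
    (fun W b => quotClass (centralIdeal hcen hn W) = b.1) (m := 1) (l := Nat.card F ^ (n * n))
    (fun W _ => ?_) ?_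
  · rwa [mul_one, Set.ncard_univ, Nat.card_coe_set_eq] at key
  · rw [Nat.one_le_iff_ne_zero, ← Nat.pos_iff_ne_zero, Set.ncard_pos (Set.toFinite _)]
    exact ⟨⟨_, _, rfl⟩, rfl⟩
  · rintro ⟨_, J, rfl⟩
    refine le_trans ?_ (ncard_quotClass_fiber_le hnil J)
    refine Set.ncard_le_ncard_of_injOn (centralIdeal hcen hn) ?_ hinj.injOn (Set.toFinite _)
    rintro W ⟨-, hW⟩
    exact ⟨Submodule.map_subtype_le _ _, hW⟩

end Classes

/-! ### Central ideals with a nonscalar derivation -/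

section Derivations

variable {F : Type u} [Field F] {V : Set (FreeNonUnitalNonAssocAlgebra F ℕ)} {n c : ℕ}

/-- A non-scalar derivation of the quotient by a central ideal `I` comes from a non-scalar matrix
whose derivation of the free algebra preserves the preimage of `I`. -/
theorem exists_nonscalar_of_not_derivationsScalar (hnil : IsStepNilpotentClass V c)
    {I : AlgIdeal F (RelFree V n)} (h : ¬ DerivationsScalar F I.Quot) :
    ∃ δ : (Fin n → F) →ₗ[F] (Fin n → F), (∀ l : F, δ ≠ l • LinearMap.id) ∧
      ∀ D : FreeNonUnitalNonAssocAlgebra F (Fin n) →ₗ[F] FreeNonUnitalNonAssocAlgebra F (Fin n),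
        IsDerivation F _ D → (∀ v, D (linForm F n v) = linForm F n (δ v)) →
        ∀ t ∈ power F (FreeNonUnitalNonAssocAlgebra F (Fin n)) c,
          relProj V n t ∈ I.toSubmodule → relProj V n (D t) ∈ I.toSubmodule := by
  unfold DerivationsScalar at h
  push Not at h
  obtain ⟨d, hd, hl⟩ := h
  have hP : power F I.Quot (c + 1) = ⊥ := hnil.1 (quotAlg I) (inClass_quot I)
  let ψ : FreeNonUnitalNonAssocAlgebra F (Fin n) →ₙₐ[F] I.Quot := I.projHom.comp (relProj V n)
  have hex : ∀ i : Fin n, ∃ v, d (I.projHom (gen V i)) - ψ (linForm F n v) ∈ power F I.Quot 2 := by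
    intro i
    obtain ⟨x, hx⟩ := I.projHom_surjective (d (I.projHom (gen V i)))
    obtain ⟨v, hv⟩ := exists_sub_linForm_mem x
    refine ⟨v, ?_⟩
    have := map_mem_power I.projHom hv
    rwa [map_sub, hx] at this
  choose r hr using hex
  let δ : (Fin n → F) →ₗ[F] (Fin n → F) := (Pi.basisFun F (Fin n)).constr F r
  have hδ : ∀ i, δ (Pi.single i 1) = r i := fun i => by
    have := (Pi.basisFun F (Fin n)).constr_basis F r i
    rwa [Pi.basisFun_apply] at this
  refine ⟨δ, fun l hδl => ?_, fun D hD hDδ t ht htI => ?_⟩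
  · obtain ⟨a, ha⟩ := hl l
    apply ha
    obtain ⟨x, rfl⟩ := I.projHom_surjective a
    clear ha
    induction x using relFree_induction with
    | gen i =>
      have h1 := hr i
      rw [← hδ, hδl, LinearMap.smul_apply, LinearMap.id_apply, map_smul, map_smul,
        linForm_single] at h1
      exact h1
    | mul a b _ _ =>
      rw [map_mul, hd, ← smul_mul_assoc]
      exact sub_mem (add_mem (mul_mem_power_two _ _) (mul_mem_power_two _ _))
        (mul_mem_power_two _ _)
    | zero => simp
    | add a b ha hb =>
      rw [map_add, map_add, smul_add, add_sub_add_comm]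
      exact add_mem ha hb
    | smul r a ha =>
      rw [map_smul, map_smul, smul_comm l r, ← smul_sub]
      exact Submodule.smul_mem _ _ ha
  -- `τ` measures how far `D` is from lifting `d`. It sends generators into the square, so it
  -- vanishes on c-th powers.
  · let τ : FreeNonUnitalNonAssocAlgebra F (Fin n) →ₗ[F] I.Quot :=
      d ∘ₗ (ψ : FreeNonUnitalNonAssocAlgebra F (Fin n) →ₗ[F] I.Quot) -
        (ψ : FreeNonUnitalNonAssocAlgebra F (Fin n) →ₗ[F] I.Quot) ∘ₗ D
    have hτ : ∀ x, τ x = d (ψ x) - ψ (D x) := fun _ => rfl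
    have hmul : ∀ x y, τ (x * y) = τ x * ψ y + ψ x * τ y := by
      intro x y
      rw [hτ, hτ, hτ, map_mul, hd, hD, map_add, map_mul, map_mul, sub_mul, mul_sub]
      abel
    have h2 := free_skewDerivation_mem_power τ ψ ψ hmul (fun i => by
      rw [hτ]
      have h1 := hr i
      rw [← hδ, ← hDδ, linForm_single] at h1
      exact h1) ht
    rw [hP, Submodule.mem_bot, hτ] at h2
    have h3 : ψ t = 0 := I.projHom_eq_zero.2 htI
    rw [h3, map_zero, zero_sub, neg_eq_zero] at h2
    exact I.projHom_eq_zero.1 h2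

/-- Each bad `I` is stable for some nonscalar matrix, and each of the q^(n²) matrices has few stable
subspaces. The condition on `n` makes the rank n - c at least e + (2s + 3). -/
theorem ncard_central_not_derivationsScalar_le [Finite F] (hnil : IsStepNilpotentClass V c)
    (hc : 2 ≤ c) (s e : ℕ) (hn : e + (2 * s + 3) + c ≤ n) :
    {I : AlgIdeal F (RelFree V n) | I.toSubmodule ≤ power F (RelFree V n) c ∧
      ¬ DerivationsScalar F I.Quot}.ncard ≤ Nat.card F ^ (n * n) *
      ((Module.finrank F (power F (RelFree V n) c) + 1) *
        Nat.card F ^ ((Module.finrank F (power F (RelFree V n) c) + 1 - s) ^ 2 / 4) +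
      Nat.card F * (Nat.card F ^ ((2 * s + 3) * Module.finrank F (power F (RelFree V n) c)) *
        ((Module.finrank F (power F (RelFree V n) c) + 1) *
          Nat.card F ^ ((Module.finrank F (power F (RelFree V n) c) + 1 - e) ^ 2 / 4)))) := by
  have := finiteDimensional_relFree hnil n
  have := finite_algIdeal (V := V) (n := n) hnil
  have : Finite (Submodule F (power F (RelFree V n) c)) := finite_submodule
  have hfin : Finite ((Fin n → F) →ₗ[F] (Fin n → F)) := Module.finite_of_finite F
  have hcard : Nat.card ((Fin n → F) →ₗ[F] (Fin n → F)) = Nat.card F ^ (n * n) := by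
    rw [card_eq_pow (F := F), Module.finrank_linearMap]
    simp
  choose D hD hDδ using exists_derivation_linForm (F := F) (n := n)
  rw [← hcard, ← mul_one (Set.ncard _)]
  refine ncard_mul_le_card_mul _
    (fun I (δ : (Fin n → F) →ₗ[F] (Fin n → F)) => (∀ l : F, δ ≠ l • LinearMap.id) ∧
      ∀ t ∈ power F (FreeNonUnitalNonAssocAlgebra F (Fin n)) c,
          relProj V n t ∈ I.toSubmodule → relProj V n (D δ t) ∈ I.toSubmodule)
    ?_ fun δ => ?_
  · rintro I ⟨-, hI⟩
    rw [Nat.one_le_iff_ne_zero, ← Nat.pos_iff_ne_zero, Set.ncard_pos (Set.toFinite _)]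
    obtain ⟨δ, h1, h2⟩ := exists_nonscalar_of_not_derivationsScalar hnil hI
    exact ⟨δ, h1, h2 (D δ) (hD δ) (hDδ δ)⟩
  · by_cases hδ : ∀ l : F, δ ≠ l • LinearMap.id
    · refine le_trans ?_ (ncard_stable_le (projPower V n c)
        (projPower V n c ∘ₗ derPower (D δ) (hD δ) c) projPower_surjective s e fun l => ?_)
      · refine Set.ncard_le_ncard_of_injOn
          (fun I => I.toSubmodule.comap (power F (RelFree V n) c).subtype) ?_ ?_ (Set.toFinite _)
        · rintro I ⟨-, -, h⟩ t ht
          exact h t t.2 ht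
        · rintro I ⟨⟨hI, -⟩, -⟩ J ⟨⟨hJ, -⟩, -⟩ h
          have h' := congr_arg (Submodule.map (power F (RelFree V n) c).subtype) h
          simp only [Submodule.map_comap_subtype, inf_eq_right.2 hI, inf_eq_right.2 hJ] at h'
          exact AlgIdeal.toSubmodule_injective h'
      · exact le_trans (by omega) (le_finrank_range_derPower hnil hc hδ (hD δ) (hDδ δ) l)
    · have : {I ∈ {I : AlgIdeal F (RelFree V n) |
          I.toSubmodule ≤ power F (RelFree V n) c ∧ ¬ DerivationsScalar F I.Quot} |
          (∀ l : F, δ ≠ l • LinearMap.id) ∧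
          ∀ t ∈ power F (FreeNonUnitalNonAssocAlgebra F (Fin n)) c,
          relProj V n t ∈ I.toSubmodule → relProj V n (D δ t) ∈ I.toSubmodule} = ∅ := by
        ext I
        simp only [Set.mem_ofPred_eq, Set.mem_empty_iff_false, iff_false]
        exact fun h => hδ h.2.1
      rw [this, Set.ncard_empty]
      exact Nat.zero_le _

end Derivations

/-! ### Ideals outside the annihilator -/

section NonCentral

variable {F : Type*} [Field F] {A : Type*} [NonUnitalNonAssocRing A] [Module F A]

/-- The ideal generated by a set. -/
def idealSpan (F : Type*) [Field F] {A : Type*} [NonUnitalNonAssocRing A] [Module F A]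
    (X : Set A) : Submodule F A := sInf {J | IsIdeal J ∧ X ⊆ J}

theorem isIdeal_idealSpan (X : Set A) : IsIdeal (idealSpan F X) := fun a x hx =>
  ⟨Submodule.mem_sInf.2 fun J hJ => (hJ.1 a x (Submodule.mem_sInf.1 hx J hJ)).1,
    Submodule.mem_sInf.2 fun J hJ => (hJ.1 a x (Submodule.mem_sInf.1 hx J hJ)).2⟩

theorem subset_idealSpan (X : Set A) : X ⊆ idealSpan F X := fun _ hx =>
  Submodule.mem_sInf.2 fun _ hJ => hJ.2 hx

theorem idealSpan_le {X : Set A} {I : Submodule F A} (hI : IsIdeal I) (h : X ⊆ I) :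
    idealSpan F X ≤ I := sInf_le ⟨hI, h⟩

/-- Counting ideals of relative dimension `k` modulo a subspace `C` which meets every ideal in a
subspace of large dimension. -/
theorem ncard_ideals_le [Finite F] [FiniteDimensional F A] (C : Submodule F A) (a k : ℕ)
    (h : ∀ I : Submodule F A, IsIdeal I →
      a * (Module.finrank F I - Module.finrank F (I ⊓ C : Submodule F A)) ≤
        Module.finrank F (I ⊓ C : Submodule F A)) :
    {I : Submodule F A | IsIdeal I ∧
      Module.finrank F I = Module.finrank F (I ⊓ C : Submodule F A) + k}.ncard ≤
    Nat.card F ^ (Module.finrank F A * k) * ((Module.finrank F C + 1) *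
      Nat.card F ^ ((Module.finrank F C + 1 - a * k) ^ 2 / 4)) := by
  have := Module.finite_of_finite F (M := A)
  have : Finite (Submodule F C) := finite_submodule
  have hcard : Nat.card (Fin k → A) = Nat.card F ^ (Module.finrank F A * k) := by
    rw [Nat.card_fun, card_eq_pow (F := F) (W := A), ← pow_mul, Nat.card_fin]
  rw [← hcard, ← mul_one (Set.ncard _)]
  refine ncard_mul_le_card_mul _
    (fun I (x : Fin k → A) => (∀ i, x i ∈ I) ∧ I = I ⊓ C ⊔ Submodule.span F (Set.range x)) ?_ ?_
  · rintro I ⟨-, hI⟩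
    rw [Nat.one_le_iff_ne_zero, ← Nat.pos_iff_ne_zero, Set.ncard_pos (Set.toFinite _)]
    exact exists_eq_sup_span_range k (I ⊓ C) I inf_le_left hI.le
  · intro x
    -- `J` depends only on `x`, and I ⊔ C = J ⊔ C, so `J` also has relative dimension `k` and the
    -- hypothesis applies to it. Then I = I ⊓ C ⊔ J is determined by its trace on `C`, which
    -- contains J ⊓ C, of dimension at least ak.
    set J := idealSpan F (Set.range x) with hJ
    have hJx : Submodule.span F (Set.range x) ≤ J := Submodule.span_le.2 (subset_idealSpan _)
    have main : ∀ I ∈ {I ∈ {I : Submodule F A | IsIdeal I ∧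
        Module.finrank F I = Module.finrank F (I ⊓ C : Submodule F A) + k} |
        (∀ i, x i ∈ I) ∧ I = I ⊓ C ⊔ Submodule.span F (Set.range x)},
        J ≤ I ∧ I = I ⊓ C ⊔ J ∧ a * k ≤ Module.finrank F (J ⊓ C : Submodule F A) := by
      rintro I ⟨⟨h1, h2⟩, h3, h4⟩
      have hJI : J ≤ I := idealSpan_le h1 (by rintro _ ⟨i, rfl⟩; exact h3 i)
      have h5 : I = I ⊓ C ⊔ J :=
        le_antisymm (h4.le.trans (sup_le_sup_left hJx _)) (sup_le inf_le_left hJI)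
      have h6 : I ⊔ C = J ⊔ C := by
        refine le_antisymm (sup_le (h5.le.trans ?_) le_sup_right) (sup_le_sup_right hJI _)
        exact sup_le (inf_le_right.trans le_sup_right) le_sup_left
      have e1 := Submodule.finrank_sup_add_finrank_inf_eq I C
      have e2 := Submodule.finrank_sup_add_finrank_inf_eq J C
      rw [h6] at e1
      have e3 := h J (isIdeal_idealSpan _)
      rw [show Module.finrank F J - Module.finrank F (J ⊓ C : Submodule F A) = k by omega] at e3
      exact ⟨hJI, h5, e3⟩
    rcases Set.eq_empty_or_nonempty {I ∈ {I : Submodule F A | IsIdeal I ∧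
        Module.finrank F I = Module.finrank F (I ⊓ C : Submodule F A) + k} |
        (∀ i, x i ∈ I) ∧ I = I ⊓ C ⊔ Submodule.span F (Set.range x)} with hemp | ⟨I0, hI0⟩
    · rw [hemp, Set.ncard_empty]; exact Nat.zero_le _
    have hJC := (main I0 hI0).2.2
    have hr : Module.finrank F (J.comap C.subtype) = Module.finrank F (J ⊓ C : Submodule F A) := by
      rw [← Submodule.finrank_map_subtype_eq, Submodule.map_comap_subtype, inf_comm]
    refine (Set.ncard_le_ncard_of_injOn (t := {W : Submodule F C | J.comap C.subtype ≤ W})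
      (fun I => I.comap C.subtype) ?_ ?_ (Set.toFinite _)).trans
      ((ncard_submodule_ge_le _).trans ?_)
    · intro I hI
      exact Submodule.comap_mono (main I hI).1
    · intro I hI I' hI' e
      have e' := congr_arg (Submodule.map C.subtype) e
      simp only [Submodule.map_comap_subtype] at e'
      rw [(main I hI).2.1, (main I' hI').2.1, inf_comm I, inf_comm I', e']
    · rw [hr]
      gcongr
      exact Nat.card_pos

end NonCentral

/-! ### Asymptotic comparison -/

section Asymptotics

/-- As d + 1 - x ≤ d - 4y, its square is at most d(d - 4y). -/
theorem sq_div_four_add_le {d x y : ℕ} (hx : x ≤ d) (hy : 4 * y + 1 ≤ x) :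
    (d + 1 - x) ^ 2 / 4 + y * d ≤ d ^ 2 / 4 := by
  have h : (d + 1 - x) ^ 2 / 4 + y * d = ((d + 1 - x) ^ 2 + 4 * (y * d)) / 4 := by omega
  rw [h]
  refine Nat.div_le_div_right ?_
  obtain ⟨m, rfl⟩ := Nat.exists_eq_add_of_le hx
  obtain ⟨z, rfl⟩ := Nat.exists_eq_add_of_le hy
  rw [show 4 * y + 1 + z + m + 1 - (4 * y + 1 + z) = m + 1 by omega]
  nlinarith [Nat.zero_le (y * z), Nat.zero_le (y * m), Nat.zero_le (z * m), Nat.zero_le (z * z),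
    Nat.zero_le (y * y)]

theorem succ_le_pow {Q d : ℕ} (hQ : 2 ≤ Q) : d + 1 ≤ Q ^ d :=
  Nat.lt_two_pow_self.trans_le (Nat.pow_le_pow_left hQ d)

variable {F : Type u} [Field F] {V : Set (FreeNonUnitalNonAssocAlgebra F ℕ)} {n c : ℕ}

theorem mul_finrank_le_of_isIdeal [FiniteDimensional F (RelFree V n)]
    (hnil : IsStepNilpotentClass V c) (hc : 2 ≤ c) (hcen : IsCentralClass V c) (hn : 2 ≤ n) {a : ℕ}
    (ha : 2 * c * (a + 1) + c ≤ n) {I : Submodule F (RelFree V n)} (hI : IsIdeal I) :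
    a * (Module.finrank F I - Module.finrank F (I ⊓ power F (RelFree V n) c : Submodule F _)) ≤
      Module.finrank F (I ⊓ power F (RelFree V n) c : Submodule F _) := by
  have h := finrank_ideal_bound hnil hcen hn hI
  have hle : Module.finrank F (I ⊓ power F (RelFree V n) c : Submodule F _) ≤
    Module.finrank F I := Submodule.finrank_mono inf_le_left
  set w := Module.finrank F (I ⊓ power F (RelFree V n) c : Submodule F _)
  obtain ⟨k, hk⟩ := Nat.exists_eq_add_of_le hle
  rw [hk, Nat.add_sub_cancel_left] at h ⊢
  have h1 : 2 * c * (a + 1) * k ≤ (n - c) * k := Nat.mul_le_mul_right _ (by omega)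
  have h2 : (2 * c) * ((a + 1) * k) ≤ (2 * c) * (w + k) := by nlinarith
  have h3 := Nat.le_of_mul_le_mul_left h2 (by omega)
  nlinarith

/-- The ideal bound applied to the whole algebra, together with codimension at least n of the c-th
power. The last estimate lets the factors q^(n²) be absorbed by a multiple of d. -/
theorem finrank_relFree_le [FiniteDimensional F (RelFree V n)]
    (hnil : IsStepNilpotentClass V c) (hc : 2 ≤ c) (hcen : IsCentralClass V c) (hn : 2 ≤ n) {a : ℕ}
    (ha1 : 1 ≤ a) (ha : 2 * c * (a + 1) + c ≤ n) :
    Module.finrank F (RelFree V n) ≤ 2 * Module.finrank F (power F (RelFree V n) c) ∧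
      n ≤ Module.finrank F (power F (RelFree V n) c) ∧
      n * n ≤ 8 * c * Module.finrank F (power F (RelFree V n) c) := by
  have htop : IsIdeal (⊤ : Submodule F (RelFree V n)) := fun _ _ _ => ⟨trivial, trivial⟩
  have h1 := mul_finrank_le_of_isIdeal hnil hc hcen hn ha htop
  have h2 := finrank_ideal_bound hnil hcen hn htop
  have h3 := finrank_power_add_le hnil hc hcen hn
  rw [top_inf_eq, finrank_top] at h1 h2
  set d := Module.finrank F (power F (RelFree V n) c)
  obtain ⟨k, hk⟩ := Nat.exists_eq_add_of_le (le_trans (Nat.le_add_right d n) h3)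
  rw [hk, Nat.add_sub_cancel_left] at h1 h2
  rw [hk] at h3 ⊢
  have hk1 : k ≤ d := le_trans (Nat.le_mul_of_pos_left k ha1) h1
  have hnk : n ≤ k := by omega
  refine ⟨by omega, by omega, ?_⟩
  have h0 : 2 * c ≤ 2 * c * (a + 1) := Nat.le_mul_of_pos_right _ (Nat.succ_pos a)
  have h4 : n ≤ 2 * (n - c) := by omega
  calc n * n ≤ 2 * (n - c) * k := Nat.mul_le_mul h4 hnk
    _ = 2 * ((n - c) * k) := by ring
    _ ≤ 2 * (2 * (c * (d + k))) := Nat.mul_le_mul_left _ h2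
    _ ≤ 2 * (2 * (c * (d + d))) := by gcongr
    _ = 8 * c * d := by ring

theorem ncard_not_central_le [Finite F] (hnil : IsStepNilpotentClass V c) (hc : 2 ≤ c)
    (hcen : IsCentralClass V c) (hn : 2 ≤ n) {a : ℕ} (ha1 : 1 ≤ a)
    (ha : 2 * c * (a + 1) + c ≤ n) :
    {I : AlgIdeal F (RelFree V n) | ¬ I.toSubmodule ≤ power F (RelFree V n) c}.ncard ≤
      ∑ k ∈ (Finset.Icc 1 (Module.finrank F (power F (RelFree V n) c))).filter
        (fun k => a * k ≤ Module.finrank F (power F (RelFree V n) c)),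
        Nat.card F ^ (Module.finrank F (RelFree V n) * k) *
          ((Module.finrank F (power F (RelFree V n) c) + 1) *
            Nat.card F ^ ((Module.finrank F (power F (RelFree V n) c) + 1 - a * k) ^ 2 / 4)) := by
  have := finiteDimensional_relFree hnil n
  have : Finite (Submodule F (RelFree V n)) := finite_submodule
  have hideal := fun (I : Submodule F (RelFree V n)) (hI : IsIdeal I) =>
    mul_finrank_le_of_isIdeal hnil hc hcen hn ha hI
  refine le_trans ?_ (Finset.sum_le_sum fun k _ =>
    ncard_ideals_le (power F (RelFree V n) c) a k hideal)
  refine le_trans ?_ (Finset.set_ncard_biUnion_le _ _)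
  refine Set.ncard_le_ncard_of_injOn AlgIdeal.toSubmodule ?_
    AlgIdeal.toSubmodule_injective.injOn (Set.toFinite _)
  intro I hI
  have h1 := hideal _ I.isIdeal
  have h2 : Module.finrank F (I.toSubmodule ⊓ power F (RelFree V n) c : Submodule F _) ≤
    Module.finrank F (power F (RelFree V n) c) := Submodule.finrank_mono inf_le_right
  have h3 : Module.finrank F (I.toSubmodule ⊓ power F (RelFree V n) c : Submodule F _) <
      Module.finrank F I.toSubmodule :=
    Submodule.finrank_lt_finrank_of_lt (lt_of_le_of_ne inf_le_left fun h => hI (inf_eq_left.1 h))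
  have h4 := Nat.le_mul_of_pos_left (Module.finrank F I.toSubmodule -
    Module.finrank F (I.toSubmodule ⊓ power F (RelFree V n) c : Submodule F _)) ha1
  simp only [Set.mem_iUnion, Finset.mem_filter, Finset.mem_Icc]
  exact ⟨Module.finrank F I.toSubmodule -
    Module.finrank F (I.toSubmodule ⊓ power F (RelFree V n) c : Submodule F _),
    ⟨⟨by omega, by omega⟩, by omega⟩, I.isIdeal, by omega⟩

theorem numeric_bound {Q d L N K s e a : ℕ} (hQ : 2 ≤ Q) (hL : L ≤ 2 * d) (hN : N ≤ K * d)
    (hd : 1 ≤ d) (hs : s = 8 * K + 9) (he : e = 4 * (2 * K + 2 * s + 6) + 1)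
    (ha : a = 4 * K + 21) (hed : e ≤ d) :
    (Q ^ N * ((d + 1) * Q ^ ((d + 1 - s) ^ 2 / 4) +
      Q * (Q ^ ((2 * s + 3) * d) * ((d + 1) * Q ^ ((d + 1 - e) ^ 2 / 4)))) +
      ∑ k ∈ (Finset.Icc 1 d).filter (fun k => a * k ≤ d),
        Q ^ (L * k) * ((d + 1) * Q ^ ((d + 1 - a * k) ^ 2 / 4))) * Q ^ (N + d) ≤
    3 * Q ^ (d ^ 2 / 4) := by
  have hQ0 : 0 < Q := by omega
  have hd1 : d + 1 ≤ Q ^ d := succ_le_pow hQ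
  have mono : ∀ {i j : ℕ}, i ≤ j → Q ^ i ≤ Q ^ j := fun h => Nat.pow_le_pow_right hQ0 h
  have t1 : Q ^ N * ((d + 1) * Q ^ ((d + 1 - s) ^ 2 / 4)) * Q ^ (N + d) ≤ Q ^ (d ^ 2 / 4) := by
    calc _ ≤ Q ^ N * (Q ^ d * Q ^ ((d + 1 - s) ^ 2 / 4)) * Q ^ (N + d) := by gcongr
      _ = Q ^ (N + (d + (d + 1 - s) ^ 2 / 4) + (N + d)) := by rw [← pow_add, ← pow_add, ← pow_add]
      _ ≤ _ := mono ?_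
    have := sq_div_four_add_le (d := d) (x := s) (y := 2 * K + 2) (by omega) (by omega)
    have e1 : (2 * K + 2) * d = 2 * (K * d) + 2 * d := by ring
    omega
  have t2 : Q ^ N * (Q * (Q ^ ((2 * s + 3) * d) * ((d + 1) * Q ^ ((d + 1 - e) ^ 2 / 4)))) *
      Q ^ (N + d) ≤ Q ^ (d ^ 2 / 4) := by
    calc _ ≤ Q ^ N * (Q ^ 1 * (Q ^ ((2 * s + 3) * d) * (Q ^ d * Q ^ ((d + 1 - e) ^ 2 / 4)))) *
          Q ^ (N + d) := by rw [pow_one]; gcongr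
      _ = Q ^ (N + (1 + ((2 * s + 3) * d + (d + (d + 1 - e) ^ 2 / 4))) + (N + d)) := by
          simp only [← pow_add]
      _ ≤ _ := mono ?_
    have := sq_div_four_add_le (d := d) (x := e) (y := 2 * K + 2 * s + 6) (by omega) (by omega)
    have e1 : (2 * K + 2 * s + 6) * d = 2 * (K * d) + (2 * s + 3) * d + 3 * d := by ring
    omega
  have t3 : (∑ k ∈ (Finset.Icc 1 d).filter (fun k => a * k ≤ d),
      Q ^ (L * k) * ((d + 1) * Q ^ ((d + 1 - a * k) ^ 2 / 4))) * Q ^ (N + d) ≤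
      Q ^ (d ^ 2 / 4) := by
    have hk : ∀ k ∈ (Finset.Icc 1 d).filter (fun k => a * k ≤ d),
        Q ^ (L * k) * ((d + 1) * Q ^ ((d + 1 - a * k) ^ 2 / 4)) * Q ^ (N + d) * Q ^ d ≤
          Q ^ (d ^ 2 / 4) := by
      intro k hk
      simp only [Finset.mem_filter, Finset.mem_Icc] at hk
      calc _ ≤ Q ^ (L * k) * (Q ^ d * Q ^ ((d + 1 - a * k) ^ 2 / 4)) * Q ^ (N + d) * Q ^ d := by
            gcongr
        _ = Q ^ (L * k + (d + (d + 1 - a * k) ^ 2 / 4) + (N + d) + d) := by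
            simp only [← pow_add]
        _ ≤ _ := mono ?_
      have h5 : 4 * (2 * k + K + 3) + 1 ≤ a * k := by
        rw [ha]; nlinarith [hk.1.1, Nat.le_mul_of_pos_right K hk.1.1]
      have := sq_div_four_add_le (d := d) (x := a * k) (y := 2 * k + K + 3) hk.2 h5
      have e1 : (2 * k + K + 3) * d = 2 * d * k + K * d + 3 * d := by ring
      have e2 : L * k ≤ 2 * d * k := Nat.mul_le_mul_right _ hL
      omega
    -- The spare factor Q^d pays for the at most d values of k.
    refine le_of_mul_le_mul_right ?_ (pow_pos hQ0 d)
    rw [Finset.sum_mul, Finset.sum_mul]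
    refine (Finset.sum_le_card_nsmul _ _ _ hk).trans ?_
    rw [smul_eq_mul, mul_comm]
    refine Nat.mul_le_mul_left _ ((Finset.card_filter_le _ _).trans ?_)
    rw [Nat.card_Icc]
    omega
  rw [mul_add (Q ^ N), add_mul, add_mul]
  omega

theorem ncard_not_derivationsScalar_le [Finite F] (hnil : IsStepNilpotentClass V c) (hc : 2 ≤ c)
    (hcen : IsCentralClass V c) :
    ∃ n₀, ∀ n, n₀ ≤ n →
      (isoClasses V (fun _ => True) n \
        isoClasses V (fun P => DerivationsScalar F P.carrier) n).ncard * n ≤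
      3 * (isoClasses V (fun _ => True) n).ncard := by
  obtain ⟨K, hK⟩ : ∃ K, K = 8 * c := ⟨_, rfl⟩
  obtain ⟨s, hs⟩ : ∃ s, s = 8 * K + 9 := ⟨_, rfl⟩
  obtain ⟨e, he⟩ : ∃ e, e = 4 * (2 * K + 2 * s + 6) + 1 := ⟨_, rfl⟩
  obtain ⟨a, ha⟩ : ∃ a, a = 4 * K + 21 := ⟨_, rfl⟩
  refine ⟨2 * c * (a + 1) + c + (e + (2 * s + 3) + c), fun n hn => ?_⟩
  have hn2 : 2 ≤ n := by omega
  have han : 2 * c * (a + 1) + c ≤ n := by omega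
  have := finiteDimensional_relFree hnil n
  have := finite_algIdeal (V := V) (n := n) hnil
  obtain ⟨hL, hnd, hnn⟩ := finrank_relFree_le hnil hc hcen hn2 (by omega : 1 ≤ a) han
  set d := Module.finrank F (power F (RelFree V n) c)
  set S := isoClasses V (fun _ => True) n
  set T := isoClasses V (fun P => DerivationsScalar F P.carrier) n
  have hQ := two_le_card_field (F := F)
  set Q := Nat.card F
  have hbad : (S \ T).ncard ≤
      Q ^ (n * n) * ((d + 1) * Q ^ ((d + 1 - s) ^ 2 / 4) +
      Q * (Q ^ ((2 * s + 3) * d) * ((d + 1) * Q ^ ((d + 1 - e) ^ 2 / 4)))) +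
      ∑ k ∈ (Finset.Icc 1 d).filter (fun k => a * k ≤ d),
        Q ^ (Module.finrank F (RelFree V n) * k) *
          ((d + 1) * Q ^ ((d + 1 - a * k) ^ 2 / 4)) := by
    refine le_trans ?_ (Nat.add_le_add
      (ncard_central_not_derivationsScalar_le hnil hc s e (by omega))
      (ncard_not_central_le hnil hc hcen hn2 (by omega : 1 ≤ a) han))
    refine (Set.ncard_le_ncard (isoClasses_diff_subset _) (Set.toFinite _)).trans
      ((Set.ncard_image_le (Set.toFinite _)).trans (le_trans (Set.ncard_le_ncard ?_
        (Set.toFinite _)) (Set.ncard_union_le _ _)))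
    intro I hI
    by_cases h : I.toSubmodule ≤ power F (RelFree V n) c
    · exact Or.inl ⟨h, hI⟩
    · exact Or.inr h
  have hnum := numeric_bound (N := n * n) hQ hL (hnn.trans_eq (by rw [hK])) (by omega) hs he ha
    (by omega : e ≤ d)
  have hS := pow_le_card_submodule.trans (card_submodule_power_le hnil hcen hn2)
  have h1 : (S \ T).ncard * Q ^ d * Q ^ (n * n) ≤ 3 * S.ncard * Q ^ (n * n) := by
    calc _ = (S \ T).ncard * Q ^ (n * n + d) := by rw [pow_add]; ring
      _ ≤ _ := (Nat.mul_le_mul_right _ hbad).trans hnum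
      _ ≤ 3 * (S.ncard * Q ^ (n * n)) := Nat.mul_le_mul_left _ hS
      _ = _ := by ring
  have h2 := Nat.le_of_mul_le_mul_right h1 (pow_pos (by omega) _)
  -- The surplus Q^d kept in the numeric bound exceeds d ≥ n.
  refine le_trans (Nat.mul_le_mul_left _ ?_) h2
  exact hnd.trans ((Nat.le_succ d).trans (succ_le_pow hQ))

end Asymptotics
end NonassocVar

theorem mainTheorem12 (F : Type u) [Field F] [Finite F] (c : ℕ) (hc : 2 ≤ c)
    (V : Set (FreeNonUnitalNonAssocAlgebra F ℕ))
    (hnil : NonassocVar.IsStepNilpotentClass V c)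
    (hcen : NonassocVar.IsCentralClass V c) :
    NonassocVar.IsGeneric
      (NonassocVar.isoClasses V fun _ => True)
      (NonassocVar.isoClasses V fun P => NonassocVar.DerivationsScalar F P.carrier) := by
  open NonassocVar in
  have hfin : ∀ n, (isoClasses V (fun _ => True) n).Finite := fun n => by
    have := finite_algIdeal (V := V) (n := n) hnil
    rw [isoClasses_true_eq]
    exact Set.finite_range _
  have hpos : ∀ n, 0 < (isoClasses V (fun _ => True) n).ncard := fun n => by
    rw [Set.ncard_pos (hfin n)]
    -- The kernel of the identity is the zero ideal, so this is the class of the free algebra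
    -- itself.
    exact ⟨_, quotClass_mem_isoClasses (kerIdeal (NonUnitalAlgHom.id F (RelFree V n))) trivial⟩
  refine ⟨hfin, fun n => isoClasses_subset _, ?_⟩
  obtain ⟨n₀, hn₀⟩ := ncard_not_derivationsScalar_le hnil hc hcen
  have hlim : Tendsto (fun n : ℕ => (1 : ℝ) - 3 / n) atTop (𝓝 1) := by
    simpa using (tendsto_const_div_atTop_nhds_zero_nat (3 : ℝ)).const_sub 1
  refine tendsto_of_tendsto_of_tendsto_of_le_of_le' hlim tendsto_const_nhds ?_ ?_
  · filter_upwards [eventually_ge_atTop n₀, eventually_gt_atTop 0] with n hn hn1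
    have h1 := hn₀ n hn
    have h2 := Set.ncard_sdiff_add_ncard_of_subset (isoClasses_subset (V := V) (n := n)
      (fun P => DerivationsScalar F P.carrier)) (hfin n)
    have hS : (0 : ℝ) < (isoClasses V (fun _ => True) n).ncard := by exact_mod_cast hpos n
    have hn' : (0 : ℝ) < n := by exact_mod_cast hn1
    have h1' : ((isoClasses V (fun _ => True) n \
        isoClasses V (fun P => DerivationsScalar F P.carrier) n).ncard : ℝ) * n ≤
        3 * (isoClasses V (fun _ => True) n).ncard := by exact_mod_cast h1
    have h2' : ((isoClasses V (fun _ => True) n \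
        isoClasses V (fun P => DerivationsScalar F P.carrier) n).ncard : ℝ) +
        (isoClasses V (fun P => DerivationsScalar F P.carrier) n).ncard =
        (isoClasses V (fun _ => True) n).ncard := by exact_mod_cast h2
    rw [le_div_iff₀ hS, sub_mul, one_mul, sub_le_iff_le_add', ← h2', add_le_add_iff_right, h2',
      div_mul_eq_mul_div, le_div_iff₀ hn']
    exact h1'
  · refine Eventually.of_forall fun n => div_le_one_of_le₀ ?_ (Nat.cast_nonneg _)
    exact_mod_cast Set.ncard_le_ncard (isoClasses_subset _) (hfin n)
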